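/- **Lemma 3.2.** For every $\epsilon>0$ there is $R_0=R_0(\epsilon)$, depending only on $\epsilon$ (not on the genus, the surface or the pants decomposition), such that the following holds for all $R\ge R_0$. Let $S=\mathbb{H}^2/G$ be a closed oriented hyperbolic surface with universal covering $\pi:\mathbb{H}^2\to S$, and let $\mathcal{P}$ be a pants decomposition of $S$ by simple closed geodesics. For a pair of pants $\Pi$ of $\mathcal{P}$ write its fundamental group as generated by elements $c_0,c_1,c_2$ running around its three boundary components with $\Pi$ on the left and satisfying $c_2c_1c_0=1$; let $\gamma_i\subset\mathbb{H}^2$ be the axis of $c_i$ and $\eta_i$ the common orthogonal of $\gamma_{i-1}$ and $\gamma_{i+1}$ (indices modulo $3$). For the curve $C\in\mathcal{P}$ covered by $\gamma_i$, the half-length $hl(C)$ is the distance along $\gamma_i$ between the feet of $\eta_{i-1}$ and $\eta_{i+1}$. If $\gamma_0$ covers $C$ and is oriented with $\Pi$ on its left, if $\Pi'$ is the pair of pants on its right, with axes $\gamma_0'=\gamma_0,\gamma_1',\gamma_2'$ and common orthogonals $\eta_i'$, then the twist $s(C)\in\mathbb{R}/hl(C)\mathbb{Z}$ is the signed distance along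 $\gamma_0$ from the foot of $\eta_1$ to the foot of $\eta_1'$. Suppose that for every $C\in\mathcal{P}$ $$\Big|hl(C)-\frac R2\Big|<\frac{\epsilon}{R}\qquad\text{and}\qquad |s(C)-1|<\frac{\epsilon}{R}$$ (the second one for some real representative of $s(C)$). Then every geodesic arc of length $1$ in $\mathbb{H}^2$ intersects at most $2R+2$ of the geodesics in $\pi^{-1}(\mathcal{P})$. -/

import Mathlib

open scoped UpperHalfPlane MatrixGroups

namespace HypPants

/-- The unit speed parametrization `t ↦ exp t * I` of the upward oriented imaginary axis. -/
noncomputable def vertical (t : ℝ) : ℍ := ⟨⟨0, Real.exp t⟩, Real.exp_pos t⟩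

/-- Every unit speed oriented geodesic of `ℍ` is `geod B` for some `B ∈ SL(2, ℝ)`, since
`SL(2, ℝ)` acts transitively on unit tangent vectors. -/
noncomputable def geod (B : SL(2, ℝ)) (t : ℝ) : ℍ := B • vertical t

/-- The complete geodesic underlying `geod B`. -/
def line (B : SL(2, ℝ)) : Set ℍ := Set.range (geod B)

/-- The open half-plane to the left of the oriented geodesic `geod B`. -/
def leftSide (B : SL(2, ℝ)) : Set ℍ := {z | (B⁻¹ • z).re < 0}

/-- The open half-plane to the right of the oriented geodesic `geod B`. -/
def rightSide (B : SL(2, ℝ)) : Set ℍ := {z | 0 < (B⁻¹ • z).re}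

/-- The image of a subset of `ℍ` under a Möbius transformation. -/
def translate (g : SL(2, ℝ)) (X : Set ℍ) : Set ℍ := (fun z : ℍ => g • z) '' X

/-- `g` is a hyperbolic transformation that translates along the oriented geodesic `geod B`,
in the positive direction, by the length `ℓ`. -/
def TranslatesAlong (g B : SL(2, ℝ)) (ℓ : ℝ) : Prop :=
  0 < ℓ ∧ ∀ t : ℝ, g • geod B t = geod B (t + ℓ)

/-- The segment `[p, q]` is the common orthogonal of the geodesics `L` and `M`: it starts at `p ∈ L`
and ends at `q ∈ M`, `p` is the foot of the perpendicular from `q` to `L`, and `q` is the foot of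
the perpendicular from `p` to `M` (used for disjoint `L` and `M`). -/
def IsCommonOrthogonal (L M : Set ℍ) (p q : ℍ) : Prop :=
  p ∈ L ∧ q ∈ M ∧ (∀ p' ∈ L, dist p q ≤ dist p' q) ∧ (∀ q' ∈ M, dist p q ≤ dist p q')

/-- `G` is the covering group of a closed oriented hyperbolic surface `S = ℍ / G` (as a group of
Möbius transformations, so matrices are understood up to sign): it acts freely, properly
discontinuously and cocompactly. -/
structure IsClosedSurfaceGroup (G : Subgroup SL(2, ℝ)) : Prop where
  free : ∀ g ∈ G, ∀ z : ℍ, g • z = z → g = 1 ∨ g = -1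
  properly_discontinuous : ∀ K : Set ℍ, IsCompact K →
    {g : SL(2, ℝ) | g ∈ G ∧ (translate g K ∩ K).Nonempty}.Finite
  cocompact : ∃ K : Set ℍ, IsCompact K ∧ ∀ z : ℍ, ∃ g ∈ G, g • z ∈ K

/-- `𝓛` is the set of all lifts to `ℍ` of a finite family of pairwise disjoint simple closed
geodesics on `ℍ / G`. Disjointness of distinct lifts expresses both that the closed geodesics are
simple and that they are disjoint. -/
structure IsLiftedMulticurve (G : Subgroup SL(2, ℝ)) (𝓛 : Set (Set ℍ)) : Prop where
  closed_geodesic : ∀ L ∈ 𝓛, ∃ B : SL(2, ℝ), ∃ g ∈ G, ∃ ℓ : ℝ, L = line B ∧ TranslatesAlong g B ℓ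
  invariant : ∀ g ∈ G, ∀ L ∈ 𝓛, translate g L ∈ 𝓛
  pairwise_disjoint : ∀ L ∈ 𝓛, ∀ M ∈ 𝓛, L ≠ M → Disjoint L M
  finite : ∃ F : Set (Set ℍ), F.Finite ∧ F ⊆ 𝓛 ∧ ∀ L ∈ 𝓛, ∃ g ∈ G, ∃ M ∈ F, L = translate g M

/-- A pair of pants of `ℍ / G` cut along the curves with lifts `𝓛`, together with a marking, seen
in `ℍ`. The set `region` is a component of the complement of the lifts; it is the universal cover
of the interior of a component of the complement of the curves on the surface, with covering group
the stabilizer of `region` in `G`. That component is a sphere with three holes: its fundamental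
group is generated by three elements `loop 0, loop 1, loop 2`, which run around its boundary curves
(with the surface on the left) and satisfy `loop 2 * loop 1 * loop 0 = 1`, and the axes
`cuff 0, cuff 1, cuff 2` of these elements are lifts of its three different boundary components,
which are all of its boundary components. (Two of the boundary components may be the same curve on
`ℍ / G`.) -/
structure MarkedPants (G : Subgroup SL(2, ℝ)) (𝓛 : Set (Set ℍ)) where
  region : Set ℍ
  cuff : Fin 3 → Set ℍ
  loop : Fin 3 → SL(2, ℝ)
  region_eq : ∃ z ∈ (⋃₀ 𝓛)ᶜ, region = connectedComponentIn (⋃₀ 𝓛)ᶜ z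
  cuff_mem : ∀ i, cuff i ∈ 𝓛
  cuff_subset : ∀ i, cuff i ⊆ closure region
  loop_mem : ∀ i, loop i ∈ G
  loop_axis : ∀ i, ∃ (B : SL(2, ℝ)) (ℓ : ℝ),
    cuff i = line B ∧ region ⊆ leftSide B ∧ TranslatesAlong (loop i) B ℓ
  relation : loop 2 * loop 1 * loop 0 = 1 ∨ loop 2 * loop 1 * loop 0 = -1
  generates : ∀ h ∈ G, translate h region = region →
    h ∈ Subgroup.closure (Set.range loop ∪ {-1})
  boundary : ∀ L ∈ 𝓛, L ⊆ closure region →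
    ∃! i, ∃ h ∈ G, translate h region = region ∧ L = translate h (cuff i)

/-- `𝓛 = π⁻¹(𝓟)` for a pants decomposition `𝓟` of `ℍ / G` by simple closed geodesics: all
components of the complement are pairs of pants. -/
structure IsLiftedPantsDecomposition (G : Subgroup SL(2, ℝ)) (𝓛 : Set (Set ℍ)) : Prop where
  multicurve : IsLiftedMulticurve G 𝓛
  pants : ∀ z ∈ (⋃₀ 𝓛)ᶜ, ∃ P : MarkedPants G 𝓛, z ∈ P.region

/-- `hl` and `s` are the (real) reduced Fenchel–Nielsen coordinates of `ℍ / G` with respect to the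
pants decomposition with lifts `𝓛`. They are functions of the curves of the pants decomposition,
that is, functions on `𝓛` which are invariant under `G`.

* `half_length`: on the lift `γᵢ` of a boundary curve of a pair of pants, `hl` is the distance
  between the feet of the common orthogonals to `γᵢ, γᵢ₊₁` and to `γᵢ, γᵢ₊₂`.
* `twist`: if one pair of pants lies to the left of the oriented lift `geod B` and another one
  to the right, then `s` is, modulo `hl`, the signed distance along `geod B` from the foot of
  a common orthogonal to `geod B` and the next lift in the left pair of pants, to the corresponding
  foot for the right pair of pants. (Reversing `geod B` does not change it.) -/
structure IsFenchelNielsen (G : Subgroup SL(2, ℝ)) (𝓛 : Set (Set ℍ)) (hl s : Set ℍ → ℝ) :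
    Prop where
  hl_invariant : ∀ g ∈ G, ∀ L ∈ 𝓛, hl (translate g L) = hl L
  s_invariant : ∀ g ∈ G, ∀ L ∈ 𝓛, s (translate g L) = s L
  half_length : ∀ (P : MarkedPants G 𝓛) (i : Fin 3), ∃ p q p' q' : ℍ,
    IsCommonOrthogonal (P.cuff i) (P.cuff (i + 1)) p q ∧
    IsCommonOrthogonal (P.cuff i) (P.cuff (i + 2)) p' q' ∧
    hl (P.cuff i) = dist p p'
  twist : ∀ (B : SL(2, ℝ)) (P Q : MarkedPants G 𝓛) (i j : Fin 3),
    P.cuff i = line B → Q.cuff j = line B →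
    P.region ⊆ leftSide B → Q.region ⊆ rightSide B →
    ∃ (t t' : ℝ) (q q' : ℍ) (k : ℤ),
      IsCommonOrthogonal (P.cuff i) (P.cuff (i + 2)) (geod B t) q ∧
      IsCommonOrthogonal (Q.cuff j) (Q.cuff (j + 2)) (geod B t') q' ∧
      t' - t = s (line B) + k * hl (line B)

/-- `a` is a geodesic arc of length `1` in `ℍ`. -/
def IsUnitGeodesicArc (a : Set ℍ) : Prop :=
  ∃ γ : ℝ → ℍ, (∀ x ∈ Set.Icc (0 : ℝ) 1, ∀ y ∈ Set.Icc (0 : ℝ) 1, dist (γ x) (γ y) = |x - y|) ∧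
    a = γ '' Set.Icc (0 : ℝ) 1

end HypPants

/-!
The constants do not depend on the surface because everything happens between two consecutive
crossings of the arc with lifts, inside one component of the complement of the lifts.

*Trigonometry.* An oriented geodesic is `geod B`, and the position of `geod A` with respect to it
is read off from the entries `a, b, c, d` of `B⁻¹ * A`: the function `side B`, the hyperbolic sine
of the signed distance to `geod B`, is `a c eᵗ + b d e⁻ᵗ` along `geod A`, and `cosh` of the
distance between points of the two geodesics is also explicit (`cosh_dist_geod`). For two geodesics
each on the left of the other (`Facing`), the foot and the length of the common orthogonal
are then given by `a b` and `c d` (`Facing.orthogonal`). The cosine rules for the right-angled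
hexagon spanned by three cuffs (`hexagon_rule`, `hexagon_dual`) show that half lengths close to
`R / 2` make the distances between cuffs close to `2 exp (-R / 4)` (`MarkedPants.short_sides`).

*Feet.* The components of the complement of the lifts are intersections of half-planes
(`mem_component_iff`), so loops preserve the region and markings can be changed. Comparing a
marking with the one obtained by a half twist shows that the feet on a cuff are equally spaced
at distance `hl`, with a neighbouring lift at each of them (`MarkedPants.exists_neighbour`). If the
arc passes in a region from a lift `L` to a lift `M` along a segment shorter than `3 / 8`, then `M`
is the neighbour of `L` at the nearest foot, since any other geodesic is kept away by that
neighbour (`two_le_of_three_facing`), and the foot is at distance at most `R / 4 - 3 / 4`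
(`MarkedPants.exists_near_foot`). The position relative to the foot is the same on `L` and on `M`
up to the length of the segment (`abs_foot_add_le`).

*Counting.* When the arc crosses a lift, the twist changes the position relative to the nearest
foot by `s`, which is about `1`: an additional multiple of `hl` is excluded, as both positions are
at most `R / 4 - 3 / 4` in absolute value. So along consecutive short passages the position drifts
monotonically through an interval of length less than `R / 2`, and at most `0.6 R + 3` of
them are possible in a row (`short_passages_le`). With more than `2 R + 2` crossings there are
three disjoint blocks of passages of this size, each containing one of length at least `3 / 8`,
and the arc would have length at least `9 / 8`.
-/

namespace HypPants

/-! ### The action on the upper half-plane and sides of geodesics -/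

theorem det_entries (C : SL(2, ℝ)) : C 0 0 * C 1 1 - C 0 1 * C 1 0 = 1 := by
  have := C.det_coe
  rwa [Matrix.det_fin_two] at this

theorem denom_pos (C : SL(2, ℝ)) (z : ℍ) :
    0 < (C 1 0 * z.re + C 1 1) ^ 2 + (C 1 0 * z.im) ^ 2 := by
  have hy := z.im_pos
  have hdet := det_entries C
  by_cases hc : C 1 0 = 0
  · have : C 1 1 ≠ 0 := by rintro h; rw [hc, h] at hdet; simp at hdet
    rw [hc]; simp; positivity
  · positivity

theorem smul_re_im (C : SL(2, ℝ)) (z : ℍ) :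
    (C • z).re = (C 0 0 * C 1 0 * (z.re ^ 2 + z.im ^ 2)
        + (C 0 0 * C 1 1 + C 0 1 * C 1 0) * z.re + C 0 1 * C 1 1) /
      ((C 1 0 * z.re + C 1 1) ^ 2 + (C 1 0 * z.im) ^ 2) ∧
    (C • z).im = z.im / ((C 1 0 * z.re + C 1 1) ^ 2 + (C 1 0 * z.im) ^ 2) := by
  have hN := denom_pos C z
  have hdet := det_entries C
  have h := UpperHalfPlane.coe_specialLinearGroup_apply C z
  have hn : Complex.normSq ((algebraMap ℝ ℝ (C 1 0) : ℝ) * (z : ℂ)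
        + ((algebraMap ℝ ℝ (C 1 1) : ℝ) : ℂ))
      = (C 1 0 * z.re + C 1 1) ^ 2 + (C 1 0 * z.im) ^ 2 := by
    simp [Complex.normSq_apply]; ring
  have h1 : ((C • z : ℍ) : ℂ).re = _ := congrArg Complex.re h
  have h2 : ((C • z : ℍ) : ℂ).im = _ := congrArg Complex.im h
  rw [Complex.div_re, hn] at h1
  rw [Complex.div_im, hn] at h2
  simp at h1 h2
  rw [h1, h2]
  constructor
  · rw [← add_div]; congr 1; ring
  · rw [← sub_div]; congr 1; linear_combination z.im * hdet

theorem vertical_re (t : ℝ) : (vertical t).re = 0 := rfl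
theorem vertical_im (t : ℝ) : (vertical t).im = Real.exp t := rfl

theorem eq_vertical {z : ℍ} (hz : z.re = 0) : z = vertical (Real.log z.im) := by
  apply UpperHalfPlane.ext
  apply Complex.ext
  · exact hz
  · change z.im = Real.exp _
    rw [Real.exp_log z.im_pos]

theorem mul_smul_geod (g B : SL(2, ℝ)) (t : ℝ) : g • geod B t = geod (g * B) t := by
  simp [geod, mul_smul]

theorem geod_rel (B A : SL(2, ℝ)) (t : ℝ) : geod A t = B • geod (B⁻¹ * A) t := by
  rw [mul_smul_geod]; simp

/-- The hyperbolic sine of the signed distance from `z` to the oriented geodesic `geod B`;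
it is negative on the left. -/
noncomputable def side (B : SL(2, ℝ)) (z : ℍ) : ℝ := (B⁻¹ • z).re / (B⁻¹ • z).im

theorem mem_leftSide {B : SL(2, ℝ)} {z : ℍ} : z ∈ leftSide B ↔ side B z < 0 := by
  simp only [leftSide, side, Set.mem_ofPred_eq, div_neg_iff]
  have := (B⁻¹ • z).im_pos
  constructor
  · intro h; right; exact ⟨h, this⟩
  · rintro (h | h)
    · linarith
    · exact h.1

theorem mem_rightSide {B : SL(2, ℝ)} {z : ℍ} : z ∈ rightSide B ↔ 0 < side B z := by
  simp only [rightSide, side, Set.mem_ofPred_eq]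
  rw [div_pos_iff_of_pos_right (B⁻¹ • z).im_pos]

theorem mem_line {B : SL(2, ℝ)} {z : ℍ} : z ∈ line B ↔ side B z = 0 := by
  have := (B⁻¹ • z).im_pos
  simp only [line, side, Set.mem_range, geod, div_eq_zero_iff, this.ne', or_false]
  constructor
  · rintro ⟨t, rfl⟩; simp [vertical_re]
  · intro h
    exact ⟨_, by rw [← eq_vertical h]; simp⟩

theorem geod_mem_line (B : SL(2, ℝ)) (t : ℝ) : geod B t ∈ line B := ⟨t, rfl⟩

theorem side_mul (g B : SL(2, ℝ)) (z : ℍ) : side (g * B) (g • z) = side B z := by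
  simp [side, mul_smul]

theorem continuous_side (B : SL(2, ℝ)) : Continuous (side B) := by
  unfold side
  have h : Continuous fun z : ℍ => B⁻¹ • z := continuous_const_smul _
  exact (UpperHalfPlane.continuous_re.comp h).div (UpperHalfPlane.continuous_im.comp h)
    fun z => (B⁻¹ • z).im_pos.ne'

theorem side_geod (B A : SL(2, ℝ)) (t : ℝ) :
    side B (geod A t) = (B⁻¹ * A) 0 0 * (B⁻¹ * A) 1 0 * Real.exp t
      + (B⁻¹ * A) 0 1 * (B⁻¹ * A) 1 1 * Real.exp (-t) := by
  set C := B⁻¹ * A with hC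
  have : B⁻¹ • geod A t = C • vertical t := by rw [mul_smul_geod]; rfl
  rw [side, this, (smul_re_im C _).1, (smul_re_im C _).2]
  have hN := denom_pos C (vertical t)
  rw [vertical_re, vertical_im] at *
  have := Real.exp_pos t
  have hx : Real.exp (-t) * Real.exp t = 1 := by rw [← Real.exp_add]; simp
  rw [div_div_div_cancel_right₀ hN.ne', div_eq_iff this.ne']
  linear_combination -(C 0 1 * C 1 1) * hx

theorem inv_mul_entries (B A : SL(2, ℝ)) :
    (A⁻¹ * B) 0 0 = (B⁻¹ * A) 1 1 ∧ (A⁻¹ * B) 0 1 = -(B⁻¹ * A) 0 1 ∧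
    (A⁻¹ * B) 1 0 = -(B⁻¹ * A) 1 0 ∧ (A⁻¹ * B) 1 1 = (B⁻¹ * A) 0 0 := by
  have : A⁻¹ * B = (B⁻¹ * A)⁻¹ := by simp
  rw [this]
  generalize B⁻¹ * A = C
  rw [Matrix.SpecialLinearGroup.SL2_inv_expl]
  simp

theorem side_geod' (B A : SL(2, ℝ)) (t : ℝ) :
    side A (geod B t) = -((B⁻¹ * A) 1 0 * (B⁻¹ * A) 1 1 * Real.exp t
      + (B⁻¹ * A) 0 0 * (B⁻¹ * A) 0 1 * Real.exp (-t)) := by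
  obtain ⟨h1, h2, h3, h4⟩ := inv_mul_entries B A
  rw [side_geod, h1, h2, h3, h4]; ring

theorem cosh_dist_geod (B A : SL(2, ℝ)) (t u : ℝ) :
    Real.cosh (dist (geod B t) (geod A u)) =
      ((B⁻¹ * A) 0 0 ^ 2 * Real.exp (u - t) + (B⁻¹ * A) 0 1 ^ 2 * Real.exp (-t - u)
        + (B⁻¹ * A) 1 0 ^ 2 * Real.exp (t + u) + (B⁻¹ * A) 1 1 ^ 2 * Real.exp (t - u)) / 2 := by
  rw [geod_rel B A u]
  set C := B⁻¹ * A with hC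
  rw [show geod B t = B • vertical t from rfl, dist_smul, show geod C u = C • vertical u from rfl,
    UpperHalfPlane.cosh_dist, Complex.dist_eq_re_im]
  rw [Real.sq_sqrt (by positivity)]
  have e1 : (↑(vertical t) : ℂ).re = 0 := rfl
  have e2 : (↑(vertical t) : ℂ).im = Real.exp t := rfl
  have e3 : (↑(C • vertical u) : ℂ).re = (C • vertical u).re := rfl
  have e4 : (↑(C • vertical u) : ℂ).im = (C • vertical u).im := rfl
  have hN := denom_pos C (vertical u)
  rw [e1, e2, e3, e4, (smul_re_im C _).1, (smul_re_im C _).2, vertical_im, vertical_re, vertical_im]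
  rw [vertical_re, vertical_im] at hN
  have hdet := det_entries C
  have p1 := Real.exp_pos t
  have p2 := Real.exp_pos u
  have x1 : Real.exp (u - t) = Real.exp u / Real.exp t := Real.exp_sub _ _
  have x2 : Real.exp (t - u) = Real.exp t / Real.exp u := Real.exp_sub _ _
  have x3 : Real.exp (-t - u) = 1 / (Real.exp t * Real.exp u) := by
    rw [← Real.exp_add, one_div, ← Real.exp_neg]; ring_nf
  rw [x1, x2, x3, Real.exp_add]
  generalize Real.exp t = x at *
  generalize Real.exp u = y at *
  generalize C 0 0 = a at *
  generalize C 0 1 = b at *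
  generalize C 1 0 = c at *
  generalize C 1 1 = d at *
  simp only [mul_zero, zero_add, add_zero] at *
  have key : (a * c * (0 ^ 2 + y ^ 2) + b * d) ^ 2 + y ^ 2
      = (d ^ 2 + (c * y) ^ 2) * (a ^ 2 * y ^ 2 + b ^ 2) := by
    linear_combination (-(y ^ 2) * (a * d - b * c) - y ^ 2) * hdet
  have hR : (a ^ 2 * (y / x) + b ^ 2 * (1 / (x * y)) + c ^ 2 * (x * y) + d ^ 2 * (x / y)) / 2
      = (a ^ 2 * y ^ 2 + b ^ 2 + x ^ 2 * (d ^ 2 + (c * y) ^ 2)) / (2 * x * y) := by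
    field_simp; ring
  rw [hR]
  generalize d ^ 2 + (c * y) ^ 2 = N at *
  generalize a * c * (0 ^ 2 + y ^ 2) + b * d = p at *
  generalize a ^ 2 * y ^ 2 + b ^ 2 = M at *
  field_simp
  linear_combination key

/-! ### Parametrizations of a geodesic -/

theorem cosh_inj_nonneg {x y : ℝ} (hx : 0 ≤ x) (hy : 0 ≤ y) (h : Real.cosh x = Real.cosh y) :
    x = y := by
  have h1 := Real.cosh_le_cosh.1 h.le
  have h2 := Real.cosh_le_cosh.1 h.ge
  rw [abs_of_nonneg hx, abs_of_nonneg hy] at *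
  linarith

theorem dist_geod_self (B : SL(2, ℝ)) (t u : ℝ) : dist (geod B t) (geod B u) = |t - u| := by
  apply cosh_inj_nonneg dist_nonneg (abs_nonneg _)
  rw [cosh_dist_geod, Real.cosh_abs, Real.cosh_eq]
  simp
  ring

/-- The element of `SL(2, ℝ)` with the given entries. -/
def ofEntries (a b c d : ℝ) (h : a * d - b * c = 1) : SL(2, ℝ) :=
  ⟨!![a, b; c, d], by rw [Matrix.det_fin_two]; simpa using h⟩

@[simp] theorem ofEntries_apply (a b c d : ℝ) (h : a * d - b * c = 1) :
    ofEntries a b c d h 0 0 = a ∧ ofEntries a b c d h 0 1 = b ∧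
    ofEntries a b c d h 1 0 = c ∧ ofEntries a b c d h 1 1 = d := ⟨rfl, rfl, rfl, rfl⟩

/-- Moving the base point of an oriented geodesic. -/
noncomputable def shift (B : SL(2, ℝ)) (c : ℝ) : SL(2, ℝ) :=
  B * ofEntries (Real.exp (c / 2)) 0 0 (Real.exp (-(c / 2))) (by simp [← Real.exp_add])

/-- Reversing an oriented geodesic. -/
noncomputable def rev (B : SL(2, ℝ)) : SL(2, ℝ) := B * ofEntries 0 1 (-1) 0 (by simp)

theorem vertical_ext {z : ℍ} {t : ℝ} (h1 : z.re = 0) (h2 : z.im = Real.exp t) : z = vertical t := by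
  rw [eq_vertical h1, h2, Real.log_exp]

/-- Two unit speed parametrizations of the same geodesic differ by a translation or by a
reflection of the parameter. -/
theorem line_eq_cases {A B : SL(2, ℝ)} (h : line A = line B) :
    (∃ c, (∀ t, geod A t = geod B (t + c)) ∧ ∀ z, side A z = side B z) ∨
    (∃ c, (∀ t, geod A t = geod B (-t + c)) ∧ ∀ z, side A z = -side B z) := by
  obtain ⟨C, rfl⟩ : ∃ C, A = B * C := ⟨B⁻¹ * A, by simp⟩
  have hz : ∀ t, C 0 0 * C 1 0 * Real.exp t + C 0 1 * C 1 1 * Real.exp (-t) = 0 := by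
    intro t
    have h1 : geod (B * C) t ∈ line B := h ▸ geod_mem_line _ t
    have := mem_line.1 h1
    rw [side_geod] at this
    simpa using this
  have hdet := det_entries C
  have e1 : C 0 0 * C 1 0 = 0 ∧ C 0 1 * C 1 1 = 0 := by
    have h0 := hz 0
    have h1 := hz (Real.log 2)
    rw [Real.exp_neg, Real.exp_log (by norm_num)] at h1
    simp at h0
    constructor <;> linarith
  have hgeod : ∀ t, geod (B * C) t = B • (C • vertical t) := fun t => by simp [geod, mul_smul]
  have hside : ∀ z, side (B * C) z = (C⁻¹ • (B⁻¹ • z)).re / (C⁻¹ • (B⁻¹ • z)).im := fun z => by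
    simp [side, mul_smul]
  have hinv : C⁻¹ 0 0 = C 1 1 ∧ C⁻¹ 0 1 = -C 0 1 ∧ C⁻¹ 1 0 = -C 1 0 ∧ C⁻¹ 1 1 = C 0 0 := by
    rw [Matrix.SpecialLinearGroup.SL2_inv_expl]; simp
  obtain ⟨i1, i2, i3, i4⟩ := hinv
  by_cases ha : C 0 0 = 0
  · right
    have hd : C 1 1 = 0 := by
      rcases mul_eq_zero.1 e1.2 with h | h
      · rw [ha, h] at hdet; simp at hdet
      · exact h
    have hbc : C 0 1 * C 1 0 = -1 := by rw [ha, hd] at hdet; linarith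
    have hc : C 1 0 ≠ 0 := by rintro h; rw [h] at hbc; simp at hbc
    refine ⟨-Real.log (C 1 0 ^ 2), fun t => ?_, fun z => ?_⟩
    · rw [hgeod, geod]
      congr 1
      apply vertical_ext
      · rw [(smul_re_im C _).1, vertical_re, ha, hd]; simp
      · rw [(smul_re_im C _).2, vertical_re, vertical_im, hd]
        rw [Real.exp_add, Real.exp_neg, Real.exp_neg, Real.exp_log (by positivity)]
        have := Real.exp_pos t
        field_simp; ring
    · rw [hside, side]
      generalize B⁻¹ • z = w
      rw [(smul_re_im _ w).1, (smul_re_im _ w).2, i1, i2, i3, i4, ha, hd]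
      have h1 := w.im_pos
      generalize w.im = y at *
      generalize w.re = x at *
      have : 0 < (-C 1 0 * x + 0) ^ 2 + (-C 1 0 * y) ^ 2 := by
        have : 0 < (C 1 0)^2 := by positivity
        nlinarith [mul_pos this (pow_pos h1 2), mul_nonneg this.le (sq_nonneg x)]
      rw [div_div_div_cancel_right₀ this.ne', ← neg_div]
      congr 1
      linear_combination x * hbc
  · left
    have hc : C 1 0 = 0 := by simpa [ha] using e1.1
    have had : C 0 0 * C 1 1 = 1 := by rw [hc] at hdet; linarith
    have hd : C 1 1 ≠ 0 := by rintro h; rw [h] at had; simp at had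
    have hb : C 0 1 = 0 := by simpa [hd] using e1.2
    refine ⟨-Real.log (C 1 1 ^ 2), fun t => ?_, fun z => ?_⟩
    · rw [hgeod, geod]
      congr 1
      apply vertical_ext
      · rw [(smul_re_im C _).1, vertical_re, hb, hc]; simp
      · rw [(smul_re_im C _).2, vertical_re, vertical_im, hc]
        rw [Real.exp_add, Real.exp_neg, Real.exp_log (by positivity)]
        field_simp; ring
    · rw [hside, side]
      generalize B⁻¹ • z = w
      rw [(smul_re_im _ w).1, (smul_re_im _ w).2, i1, i2, i3, i4, hb, hc]
      have h1 := w.im_pos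
      generalize w.im = y at *
      generalize w.re = x at *
      have : 0 < (-0 * x + C 0 0) ^ 2 + (-0 * y) ^ 2 := by
        have : 0 < (C 0 0)^2 := by positivity
        linarith
      rw [div_div_div_cancel_right₀ this.ne']
      congr 1
      linear_combination x * had

theorem geod_shift (B : SL(2, ℝ)) (c t : ℝ) : geod (shift B c) t = geod B (t + c) := by
  rw [shift, geod, mul_smul, geod]
  congr 1
  apply vertical_ext
  · rw [(smul_re_im _ _).1, vertical_re]; simp
  · rw [(smul_re_im _ _).2, vertical_re, vertical_im]
    simp [Real.exp_add]
    rw [← Real.exp_nat_mul, div_eq_mul_inv, ← Real.exp_neg]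
    congr 2; push_cast; ring

theorem geod_rev (B : SL(2, ℝ)) (t : ℝ) : geod (rev B) t = geod B (-t) := by
  rw [rev, geod, mul_smul, geod]
  congr 1
  apply vertical_ext
  · rw [(smul_re_im _ _).1, vertical_re]; simp
  · rw [(smul_re_im _ _).2, vertical_re, vertical_im]
    simp [Real.exp_neg]
    have := Real.exp_pos t
    field_simp

theorem line_shift (B : SL(2, ℝ)) (c : ℝ) : line (shift B c) = line B := by
  ext z
  constructor
  · rintro ⟨t, rfl⟩; exact ⟨_, (geod_shift B c t).symm⟩
  · rintro ⟨t, rfl⟩; exact ⟨t - c, by rw [geod_shift]; simp⟩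

theorem line_rev (B : SL(2, ℝ)) : line (rev B) = line B := by
  ext z
  constructor
  · rintro ⟨t, rfl⟩; exact ⟨_, (geod_rev B t).symm⟩
  · rintro ⟨t, rfl⟩; exact ⟨-t, by rw [geod_rev]; simp⟩

theorem geod_injective (B : SL(2, ℝ)) : Function.Injective (geod B) := by
  intro t u h
  have := dist_geod_self B t u
  rw [h, dist_self] at this
  exact sub_eq_zero.1 (abs_eq_zero.1 this.symm)

theorem side_shift (B : SL(2, ℝ)) (c : ℝ) (z : ℍ) : side (shift B c) z = side B z := by
  rcases line_eq_cases (line_shift B c) with ⟨_, _, h⟩ | ⟨k, h, _⟩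
  · exact h z
  · have h0 := geod_injective B ((geod_shift B c 0).symm.trans (h 0))
    have h1 := geod_injective B ((geod_shift B c 1).symm.trans (h 1))
    linarith

theorem side_rev (B : SL(2, ℝ)) (z : ℍ) : side (rev B) z = -side B z := by
  rcases line_eq_cases (line_rev B) with ⟨k, h, _⟩ | ⟨_, _, h⟩
  · have h0 := geod_injective B ((geod_rev B 0).symm.trans (h 0))
    have h1 := geod_injective B ((geod_rev B 1).symm.trans (h 1))
    linarith
  · exact h z

/-- Same line and a common point on the left: the parametrizations differ by a translation. -/
theorem geod_eq_of_leftSide {A B : SL(2, ℝ)} (h : line A = line B) {z : ℍ} (hA : z ∈ leftSide A)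
    (hB : z ∈ leftSide B) : ∃ c, ∀ t, geod A t = geod B (t + c) := by
  rcases line_eq_cases h with ⟨c, h1, _⟩ | ⟨c, _, h2⟩
  · exact ⟨c, h1⟩
  · rw [mem_leftSide] at hA hB
    rw [h2] at hA
    linarith

theorem side_mul_side_of_line_eq {A B : SL(2, ℝ)} (h : line A = line B) (z w : ℍ) :
    side A z * side A w = side B z * side B w := by
  rcases line_eq_cases h with ⟨_, _, h⟩ | ⟨_, _, h⟩ <;> rw [h, h]
  ring

/-- Along a geodesic, `side` solves `f'' = f`. -/
theorem side_interp (B A : SL(2, ℝ)) (u t v : ℝ) :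
    Real.sinh (v - u) * side B (geod A t) =
      Real.sinh (v - t) * side B (geod A u) + Real.sinh (t - u) * side B (geod A v) := by
  simp only [side_geod, Real.sinh_eq]
  have h : ∀ x y : ℝ, Real.exp (x - y) = Real.exp x * Real.exp (-y) := fun x y => by
    rw [← Real.exp_add]; ring_nf
  simp only [neg_sub, h]
  have h1 : Real.exp u * Real.exp (-u) = 1 := by rw [← Real.exp_add]; simp
  have h2 : Real.exp t * Real.exp (-t) = 1 := by rw [← Real.exp_add]; simp
  have h3 : Real.exp v * Real.exp (-v) = 1 := by rw [← Real.exp_add]; simp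
  generalize (B⁻¹ * A) 0 0 * (B⁻¹ * A) 1 0 = p
  generalize (B⁻¹ * A) 0 1 * (B⁻¹ * A) 1 1 = q
  generalize Real.exp u = x at *
  generalize Real.exp (-u) = x' at *
  generalize Real.exp t = y at *
  generalize Real.exp (-t) = y' at *
  generalize Real.exp v = w at *
  generalize Real.exp (-v) = w' at *
  ring_nf

/-! ### Geodesic segments and distances -/

/-- Any two points are joined by a geodesic segment. -/
theorem exists_geod (z w : ℍ) : ∃ (A : SL(2, ℝ)) (T : ℝ), 0 ≤ T ∧ geod A 0 = z ∧ geod A T = w := by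
  have hI : UpperHalfPlane.I = vertical 0 := vertical_ext (by simp) (by simp)
  set g := z.toSL2R with hg
  have hgz : g • UpperHalfPlane.I = z := z.toSL2R_smul_I
  set v := g⁻¹ • w with hv
  -- a rotation about `I` moving `v` to the imaginary axis
  obtain ⟨θ, -, hθ⟩ : ∃ θ ∈ Set.Icc (0 : ℝ) Real.pi,
      (-(Real.cos θ * Real.sin θ) * (v.re ^ 2 + v.im ^ 2 - 1)
        + (Real.cos θ ^ 2 - Real.sin θ ^ 2) * v.re) = 0 := by
    have hc : Continuous fun θ : ℝ => (-(Real.cos θ * Real.sin θ) * (v.re ^ 2 + v.im ^ 2 - 1)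
        + (Real.cos θ ^ 2 - Real.sin θ ^ 2) * v.re) := by fun_prop
    have hpi := Real.pi_pos
    rcases le_total 0 v.re with h | h
    · obtain ⟨θ, h1, h2⟩ := intermediate_value_Icc' (a := 0) (b := Real.pi / 2) (by linarith)
        hc.continuousOn (show (0 : ℝ) ∈ _ by simp [h])
      exact ⟨θ, ⟨h1.1, by linarith [h1.2]⟩, h2⟩
    · obtain ⟨θ, h1, h2⟩ := intermediate_value_Icc (a := 0) (b := Real.pi / 2) (by linarith)
        hc.continuousOn (show (0 : ℝ) ∈ _ by simp [h])
      exact ⟨θ, ⟨h1.1, by linarith [h1.2]⟩, h2⟩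
  have hcs := Real.cos_sq_add_sin_sq θ
  set K := ofEntries (Real.cos θ) (-Real.sin θ) (Real.sin θ) (Real.cos θ) (by linarith) with hK
  set K' := ofEntries (Real.cos θ) (Real.sin θ) (-Real.sin θ) (Real.cos θ) (by linarith) with hK'
  have hKI : K • UpperHalfPlane.I = UpperHalfPlane.I := by
    rw [hI]
    apply vertical_ext
    · rw [(smul_re_im _ _).1]; simp [vertical_re, vertical_im, hK]
      ring
    · rw [(smul_re_im _ _).2]; simp [vertical_re, vertical_im, hK]
  have hKK : K⁻¹ = K' := by
    rw [Matrix.SpecialLinearGroup.SL2_inv_expl]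
    apply Subtype.ext
    simp [hK, hK', ofEntries]
    rfl
  have hre : (K⁻¹ • v).re = 0 := by
    rw [hKK, (smul_re_im _ _).1]
    simp [hK']
    left
    linear_combination hθ
  have e0 : geod (g * K) 0 = z := by rw [geod, ← hI, mul_smul, hKI, hgz]
  obtain ⟨T, hT⟩ : ∃ T, geod (g * K) T = w := by
    refine ⟨Real.log (K⁻¹ • v).im, ?_⟩
    rw [geod, ← eq_vertical hre, hv]
    simp [mul_smul]
  rcases le_total 0 T with h | h
  · exact ⟨_, T, h, e0, hT⟩
  · exact ⟨rev (g * K), -T, by linarith, by rw [geod_rev]; simpa using e0,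
      by rw [geod_rev]; simpa using hT⟩

/-- A point whose distances to the ends of a geodesic segment add up to its length lies on it. -/
theorem eq_geod_of_dist {A : SL(2, ℝ)} {T t : ℝ} (hT : 0 < T) {u : ℍ}
    (h0 : dist (geod A 0) u = t) (h1 : dist u (geod A T) = T - t) : u = geod A t := by
  obtain ⟨v, rfl⟩ : ∃ v, u = A • v := ⟨A⁻¹ • u, by simp⟩
  unfold geod at *
  rw [dist_smul] at h0 h1
  congr 1
  have c0 := UpperHalfPlane.cosh_dist (vertical 0) v
  have c1 := UpperHalfPlane.cosh_dist v (vertical T)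
  rw [h0, Complex.dist_eq_re_im, Real.sq_sqrt (by positivity)] at c0
  rw [h1, Complex.dist_eq_re_im, Real.sq_sqrt (by positivity)] at c1
  simp only [UpperHalfPlane.coe_re, UpperHalfPlane.coe_im, vertical_re, vertical_im,
    Real.exp_zero] at c0 c1
  have hy := v.im_pos
  have hE : 1 < Real.exp T := by simpa using hT
  have p := Real.exp_pos t
  have q := Real.exp_pos T
  rw [Real.cosh_eq] at c0 c1
  have hn : Real.exp (-(T - t)) = Real.exp t / Real.exp T := by rw [neg_sub, Real.exp_sub]
  rw [hn, Real.exp_sub] at c1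
  rw [Real.exp_neg] at c0
  have key : v.im = Real.exp t := by
    field_simp at c0 c1
    have : (Real.exp T ^ 2 - 1) * (v.im - Real.exp t) = 0 := by
      linear_combination  (c1 - c0)
    rcases mul_eq_zero.1 this with h | h
    · nlinarith
    · linarith
  apply vertical_ext _ key
  rw [key] at c0
  field_simp at c0
  have : v.re ^ 2 = 0 := by linarith
  simpa using this

/-- A unit speed arc is part of a geodesic. -/
theorem IsUnitGeodesicArc.exists_geod {a : Set ℍ} (ha : IsUnitGeodesicArc a) :
    ∃ A : SL(2, ℝ), a = geod A '' Set.Icc 0 1 := by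
  obtain ⟨γ, hγ, rfl⟩ := ha
  obtain ⟨A, T, hT, h0, h1⟩ := HypPants.exists_geod (γ 0) (γ 1)
  have hT1 : T = 1 := by
    have := hγ 0 (by simp) 1 (by simp)
    rw [← h0, ← h1, dist_geod_self] at this
    simpa [abs_of_nonneg hT] using this
  subst hT1
  refine ⟨A, Set.image_congr fun t ht => ?_⟩
  apply eq_geod_of_dist one_pos
  · rw [h0, hγ 0 (by simp) t ht]; simp [abs_of_nonneg ht.1]
  · rw [h1, hγ t ht 1 (by simp), abs_sub_comm, abs_of_nonneg]; linarith [ht.2]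

/-- The distance from a point to a geodesic bounds its `side`. -/
theorem abs_side_le_sinh_dist (B A : SL(2, ℝ)) (t u : ℝ) :
    |side A (geod B t)| ≤ Real.sinh (dist (geod B t) (geod A u)) := by
  have hD : 0 ≤ Real.sinh (dist (geod B t) (geod A u)) := Real.sinh_nonneg_iff.2 dist_nonneg
  refine abs_le_of_sq_le_sq ?_ hD
  rw [Real.sinh_sq, cosh_dist_geod, side_geod']
  have hdet := det_entries (B⁻¹ * A)
  generalize (B⁻¹ * A) 0 0 = a at *
  generalize (B⁻¹ * A) 0 1 = b at *
  generalize (B⁻¹ * A) 1 0 = c at *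
  generalize (B⁻¹ * A) 1 1 = d at *
  have s1 : Real.exp (u - t) = Real.exp u * Real.exp (-t) := by rw [← Real.exp_add]; ring_nf
  have s2 : Real.exp (-t - u) = Real.exp (-t) * Real.exp (-u) := by rw [← Real.exp_add]; ring_nf
  have s3 : Real.exp (t - u) = Real.exp t * Real.exp (-u) := by rw [← Real.exp_add]; ring_nf
  rw [s1, s2, s3, Real.exp_add]
  have h1 : Real.exp u * Real.exp (-u) = 1 := by rw [← Real.exp_add]; simp
  have h2 : Real.exp t * Real.exp (-t) = 1 := by rw [← Real.exp_add]; simp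
  generalize Real.exp u = x at *
  generalize Real.exp (-u) = x' at *
  generalize Real.exp t = y at *
  generalize Real.exp (-t) = y' at *
  -- for `M = diag(e^(-t/2), e^(t/2)) * (B⁻¹ * A) * diag(e^(u/2), e^(-u/2))` the matrix `Mᵀ * M` has
  -- determinant one, and the product of its diagonal entries is at most the square of half
  -- their sum
  have key : (x * (a ^ 2 * y' + c ^ 2 * y)) * (x' * (b ^ 2 * y' + d ^ 2 * y))
      - (c * d * y + a * b * y') ^ 2 = 1 := by
    have : (a ^ 2 * y' + c ^ 2 * y) * (b ^ 2 * y' + d ^ 2 * y)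
        - (c * d * y + a * b * y') ^ 2 = 1 := by
      linear_combination (a*d-b*c)^2 * h2 + (a*d-b*c+1) * hdet
    linear_combination this + (a ^ 2 * y' + c ^ 2 * y) * (b ^ 2 * y' + d ^ 2 * y) * h1
  nlinarith [sq_nonneg (x * (a ^ 2 * y' + c ^ 2 * y) - x' * (b ^ 2 * y' + d ^ 2 * y))]

/-! ### Facing geodesics and their common orthogonals -/

/-- Two oriented geodesics, each on the left of the other. -/
def Facing (B A : SL(2, ℝ)) : Prop := line A ⊆ leftSide B ∧ line B ⊆ leftSide A

theorem Facing.symm {B A : SL(2, ℝ)} (h : Facing B A) : Facing A B := ⟨h.2, h.1⟩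

/-- Minus the Minkowski product of the unit normal vectors of two oriented geodesics; for facing
ones with a common orthogonal it is the hyperbolic cosine of their distance. -/
noncomputable def gram (B A : SL(2, ℝ)) : ℝ :=
  -((B⁻¹ * A) 0 0 * (B⁻¹ * A) 1 1 + (B⁻¹ * A) 0 1 * (B⁻¹ * A) 1 0)

theorem gram_comm (B A : SL(2, ℝ)) : gram A B = gram B A := by
  obtain ⟨h1, h2, h3, h4⟩ := inv_mul_entries B A
  rw [gram, gram, h1, h2, h3, h4]; ring

theorem nonpos_of_forall_exp {p q : ℝ} (h : ∀ t : ℝ, p * Real.exp t + q * Real.exp (-t) < 0) :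
    p ≤ 0 := by
  by_contra! hp
  have hr : 0 < (|q| + 1) / p := by positivity
  have := h (Real.log √((|q| + 1) / p))
  rw [Real.exp_neg, Real.exp_log (by positivity)] at this
  have hs := Real.sq_sqrt hr.le
  have hs0 : 0 < √((|q| + 1) / p) := by positivity
  generalize √((|q| + 1) / p) = s at *
  rw [eq_div_iff hp.ne'] at hs
  have h2 : (p * s + q * s⁻¹) * s < 0 := mul_neg_of_neg_of_pos this hs0
  have h3 : (p * s + q * s⁻¹) * s = s ^ 2 * p + q := by field_simp
  rw [h3, hs] at h2
  linarith [neg_abs_le q]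

/-- The signs of the entries of the matrix relating two facing geodesics. -/
theorem Facing.entries {B A : SL(2, ℝ)} (h : Facing B A) :
    (B⁻¹ * A) 0 0 * (B⁻¹ * A) 1 0 ≤ 0 ∧ (B⁻¹ * A) 0 1 * (B⁻¹ * A) 1 1 ≤ 0 ∧
    0 ≤ (B⁻¹ * A) 1 0 * (B⁻¹ * A) 1 1 ∧ 0 ≤ (B⁻¹ * A) 0 0 * (B⁻¹ * A) 0 1 ∧
    (B⁻¹ * A) 0 1 * (B⁻¹ * A) 1 0 ≤ -1 := by
  have h1 : ∀ t, (B⁻¹ * A) 0 0 * (B⁻¹ * A) 1 0 * Real.exp t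
      + (B⁻¹ * A) 0 1 * (B⁻¹ * A) 1 1 * Real.exp (-t) < 0 := fun t => by
    rw [← side_geod]; exact mem_leftSide.1 (h.1 (geod_mem_line A t))
  have h2 : ∀ t, -((B⁻¹ * A) 1 0 * (B⁻¹ * A) 1 1) * Real.exp t
      + -((B⁻¹ * A) 0 0 * (B⁻¹ * A) 0 1) * Real.exp (-t) < 0 := fun t => by
    have := mem_leftSide.1 (h.2 (geod_mem_line B t))
    rw [side_geod'] at this
    linarith
  have e1 := nonpos_of_forall_exp h1
  have e2 := nonpos_of_forall_exp (p := (B⁻¹ * A) 0 1 * (B⁻¹ * A) 1 1)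
    (q := (B⁻¹ * A) 0 0 * (B⁻¹ * A) 1 0) fun t => by have := h1 (-t); rw [neg_neg] at this; linarith
  have e3 := nonpos_of_forall_exp h2
  have e4 := nonpos_of_forall_exp (p := -((B⁻¹ * A) 0 0 * (B⁻¹ * A) 0 1))
    (q := -((B⁻¹ * A) 1 0 * (B⁻¹ * A) 1 1)) fun t => by
      have := h2 (-t); rw [neg_neg] at this; linarith
  have h0 := h1 0
  have hdet := det_entries (B⁻¹ * A)
  simp only [Real.exp_zero, neg_zero, mul_one] at h0
  refine ⟨e1, e2, by linarith, by linarith, ?_⟩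
  generalize (B⁻¹ * A) 0 0 = a at *
  generalize (B⁻¹ * A) 0 1 = b at *
  generalize (B⁻¹ * A) 1 0 = c at *
  generalize (B⁻¹ * A) 1 1 = d at *
  have h4 : 0 ≤ (b * c + 1) * (b * c) := by
    have : (b * c + 1) * (b * c) = (c * d) * (a * b) := by
      linear_combination -(b * c) * hdet
    rw [this]
    exact mul_nonneg (by linarith) (by linarith)
  by_contra! hbc
  have hbc0 : 0 ≤ b * c := by
    by_contra! h5
    nlinarith
  have had : 0 < a * d := by linarith
  -- then `a * c` and `c * d` force `c = 0`, and `b * d` and `a * b` force `b = 0`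
  have hc : c = 0 := by
    by_contra hc
    have : (a * c) * (c * d) = (a * d) * c ^ 2 := by ring
    have h6 : 0 < (a * d) * c ^ 2 := by positivity
    have h7 : (a * c) * (c * d) ≤ 0 := mul_nonpos_of_nonpos_of_nonneg e1 (by linarith)
    linarith
  have hb : b = 0 := by
    by_contra hb
    have : (b * d) * (a * b) = (a * d) * b ^ 2 := by ring
    have h6 : 0 < (a * d) * b ^ 2 := by positivity
    have h7 : (b * d) * (a * b) ≤ 0 := mul_nonpos_of_nonpos_of_nonneg e2 (by linarith)
    linarith
  rw [hc, hb] at h0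
  simp at h0

theorem Facing.one_le_gram {B A : SL(2, ℝ)} (h : Facing B A) : 1 ≤ gram B A := by
  have := h.entries.2.2.2.2
  have hdet := det_entries (B⁻¹ * A)
  rw [gram]; linarith

theorem eq_of_exp_min {U V f : ℝ} (h : ∀ t : ℝ, U * Real.exp (-f) + V * Real.exp f
    ≤ U * Real.exp (-t) + V * Real.exp t) : U * Real.exp (-f) = V * Real.exp f := by
  have hd : HasDerivAt (fun t : ℝ => U * Real.exp (-t) + V * Real.exp t)
      (U * (Real.exp (-f) * (-1)) + V * Real.exp f) f :=
    ((hasDerivAt_neg f).exp.const_mul U).add ((Real.hasDerivAt_exp f).const_mul V)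
  have hm : IsLocalMin (fun t : ℝ => U * Real.exp (-t) + V * Real.exp t) f :=
    Filter.Eventually.of_forall h
  have := hm.hasDerivAt_eq_zero hd
  linarith

/-- The foot and the length of the common orthogonal, in terms of matrix entries. -/
theorem Facing.orthogonal {B A : SL(2, ℝ)} (h : Facing B A) {f : ℝ} {q : ℍ}
    (ho : IsCommonOrthogonal (line B) (line A) (geod B f) q) :
    2 * ((B⁻¹ * A) 0 0 * (B⁻¹ * A) 0 1) = Real.sinh (dist (geod B f) q) * Real.exp f ∧
    2 * ((B⁻¹ * A) 1 0 * (B⁻¹ * A) 1 1) = Real.sinh (dist (geod B f) q) * Real.exp (-f) ∧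
    gram B A = Real.cosh (dist (geod B f) q) ∧ 0 < Real.sinh (dist (geod B f) q) := by
  obtain ⟨-, ⟨g, rfl⟩, m1, m2⟩ := ho
  have c1 : ∀ t, Real.cosh (dist (geod B f) (geod A g)) ≤ Real.cosh (dist (geod B t) (geod A g)) :=
    fun t => Real.cosh_le_cosh.2 (by
      rw [abs_of_nonneg dist_nonneg, abs_of_nonneg dist_nonneg]; exact m1 _ (geod_mem_line B t))
  have c2 : ∀ t, Real.cosh (dist (geod B f) (geod A g)) ≤ Real.cosh (dist (geod B f) (geod A t)) :=
    fun t => Real.cosh_le_cosh.2 (by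
      rw [abs_of_nonneg dist_nonneg, abs_of_nonneg dist_nonneg]; exact m2 _ (geod_mem_line A t))
  have hS0 : 0 ≤ Real.sinh (dist (geod B f) (geod A g)) := Real.sinh_nonneg_iff.2 dist_nonneg
  have hS2 := Real.sinh_sq (dist (geod B f) (geod A g))
  obtain ⟨e1, e2, e3, e4, e5⟩ := h.entries
  have hdet := det_entries (B⁻¹ * A)
  have hpos := mem_leftSide.1 (h.2 (geod_mem_line B 0))
  rw [side_geod'] at hpos
  simp only [Real.exp_zero, neg_zero, mul_one] at hpos
  have hD := cosh_dist_geod B A f g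
  simp only [cosh_dist_geod B A] at c1 c2
  rw [gram]
  generalize Real.sinh (dist (geod B f) (geod A g)) = S at *
  generalize Real.cosh (dist (geod B f) (geod A g)) = X at *
  generalize (B⁻¹ * A) 0 0 = a at *
  generalize (B⁻¹ * A) 0 1 = b at *
  generalize (B⁻¹ * A) 1 0 = c at *
  generalize (B⁻¹ * A) 1 1 = d at *
  have s1 : ∀ x y : ℝ, Real.exp (x - y) = Real.exp x * Real.exp (-y) := fun x y => by
    rw [← Real.exp_add]; ring_nf
  simp only [s1, Real.exp_add] at c1 c2 hD
  -- minimality in each variable, as two critical point equations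
  have m1' := eq_of_exp_min (U := a ^ 2 * Real.exp g + b ^ 2 * Real.exp (-g))
    (V := c ^ 2 * Real.exp g + d ^ 2 * Real.exp (-g)) (f := f) fun t => by linarith [c1 t]
  have m2' := eq_of_exp_min (U := b ^ 2 * Real.exp (-f) + d ^ 2 * Real.exp f)
    (V := a ^ 2 * Real.exp (-f) + c ^ 2 * Real.exp f) (f := g) fun t => by linarith [c2 t]
  have hF : Real.exp f * Real.exp (-f) = 1 := by rw [← Real.exp_add]; simp
  have hG : Real.exp g * Real.exp (-g) = 1 := by rw [← Real.exp_add]; simp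
  have hF0 := Real.exp_pos f
  have hG0 := Real.exp_pos g
  have hF1 := Real.exp_pos (-f)
  have hG1 := Real.exp_pos (-g)
  generalize Real.exp f = F at *
  generalize Real.exp (-f) = F' at *
  generalize Real.exp g = G at *
  generalize Real.exp (-g) = G' at *
  have hα : a ^ 2 * (G * F') = d ^ 2 * (F * G') := by linarith
  have hβ : b ^ 2 * (F' * G') = c ^ 2 * (F * G) := by linarith
  have had : a * d ≤ 0 := by linarith
  have hα1 : a ^ 2 * (G * F') = -(a * d) := by
    rw [← sq_eq_sq₀ (by positivity) (by linarith)]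
    calc (a ^ 2 * (G * F')) ^ 2 = (a ^ 2 * (G * F')) * (d ^ 2 * (F * G')) := by rw [← hα]; ring
      _ = (a * d) ^ 2 * (F * F') * (G * G') := by ring
      _ = _ := by rw [hF, hG]; ring
  have hβ1 : b ^ 2 * (F' * G') = -(b * c) := by
    rw [← sq_eq_sq₀ (by positivity) (by linarith)]
    calc (b ^ 2 * (F' * G')) ^ 2 = (b ^ 2 * (F' * G')) * (c ^ 2 * (F * G)) := by rw [← hβ]; ring
      _ = (b * c) ^ 2 * (F * F') * (G * G') := by ring
      _ = _ := by rw [hF, hG]; ring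
  have hX : X = -(a * d + b * c) := by
    rw [hD]; linarith
  have hS : S ^ 2 = 4 * ((a * d) * (b * c)) := by
    rw [hS2, hX]
    linear_combination (-(a * d - b * c) - 1) * -1 * hdet
  have q1 : 2 * (a * b) = S * F := by
    rw [← sq_eq_sq₀ (by linarith) (by positivity), mul_pow S F, hS]
    have : (a * b) ^ 2 * (F' * F') = (a * d) * (b * c) := by
      calc _ = (a ^ 2 * (G * F')) * (b ^ 2 * (F' * G'))
            + (a * b) ^ 2 * (F' * F') * (1 - G * G') := by ring
        _ = _ := by rw [hα1, hβ1, hG]; ring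
    calc (2 * (a * b)) ^ 2 = 4 * ((a * b) ^ 2 * (F' * F')) * F ^ 2
          + 4 * (a * b) ^ 2 * (1 - (F * F') ^ 2) := by ring
      _ = _ := by rw [this, hF]; ring
  have q2 : 2 * (c * d) = S * F' := by
    rw [← sq_eq_sq₀ (by linarith) (by positivity), mul_pow S F', hS]
    have : (c * d) ^ 2 * (F * F) = (a * d) * (b * c) := by
      calc _ = (d ^ 2 * (F * G')) * (c ^ 2 * (F * G)) + (c * d) ^ 2 * (F * F) * (1 - G * G') := by
            ring
        _ = _ := by rw [← hα, ← hβ, hα1, hβ1, hG]; ring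
    calc (2 * (c * d)) ^ 2 = 4 * ((c * d) ^ 2 * (F * F)) * F' ^ 2
          + 4 * (c * d) ^ 2 * (1 - (F * F') ^ 2) := by ring
      _ = _ := by rw [this, hF]; ring
  refine ⟨q1, q2, hX.symm, ?_⟩
  rcases hS0.eq_or_lt with h0 | h0
  · rw [← h0] at q1 q2
    simp only [zero_mul] at q1 q2
    linarith
  · exact h0

/-- The Minkowski product of two normal vectors, in the frame of a third geodesic. -/
theorem gram_add_mul (B A N : SL(2, ℝ)) : gram A N + gram B A * gram B N =
    2 * ((B⁻¹ * A) 0 0 * (B⁻¹ * A) 0 1 * ((B⁻¹ * N) 1 0 * (B⁻¹ * N) 1 1)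
      + (B⁻¹ * A) 1 0 * (B⁻¹ * A) 1 1 * ((B⁻¹ * N) 0 0 * (B⁻¹ * N) 0 1)) := by
  have hm : A⁻¹ * N = (A⁻¹ * B) * (B⁻¹ * N) := by group
  obtain ⟨h1, h2, h3, h4⟩ := inv_mul_entries B A
  have hd1 := det_entries (B⁻¹ * A)
  have hd2 := det_entries (B⁻¹ * N)
  have hmul : ∀ (X Y : SL(2, ℝ)) (i j : Fin 2), (X * Y) i j = X i 0 * Y 0 j + X i 1 * Y 1 j :=
    fun X Y i j => by
      rw [Matrix.SpecialLinearGroup.coe_mul, Matrix.mul_apply, Fin.sum_univ_two]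
  rw [gram, gram, gram, hm]
  simp only [hmul (A⁻¹ * B) (B⁻¹ * N), h1, h2, h3, h4]
  generalize (B⁻¹ * A) 0 0 = a at *
  generalize (B⁻¹ * A) 0 1 = b at *
  generalize (B⁻¹ * A) 1 0 = c at *
  generalize (B⁻¹ * A) 1 1 = d at *
  ring

/-- The cosine rule of the right-angled hexagon spanned by three facing geodesics. -/
theorem hexagon_rule {B A N : SL(2, ℝ)} (hA : Facing B A) (hN : Facing B N) {f g : ℝ} {q r : ℍ}
    (ho : IsCommonOrthogonal (line B) (line A) (geod B f) q)
    (ho' : IsCommonOrthogonal (line B) (line N) (geod B g) r) :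
    Real.sinh (dist (geod B f) q) * Real.sinh (dist (geod B g) r) * Real.cosh (f - g) =
      gram A N + gram B A * gram B N := by
  obtain ⟨a1, a2, -, -⟩ := hA.orthogonal ho
  obtain ⟨b1, b2, -, -⟩ := hN.orthogonal ho'
  rw [gram_add_mul, Real.cosh_eq]
  have s1 : ∀ x y : ℝ, Real.exp (x - y) = Real.exp x * Real.exp (-y) := fun x y => by
    rw [← Real.exp_add]; ring_nf
  rw [neg_sub, s1, s1]
  linear_combination -(2 * ((B⁻¹ * N) 1 0 * (B⁻¹ * N) 1 1)) * a1 / 2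
    - (Real.sinh (dist (geod B f) q) * Real.exp f) / 2 * b2
    - (2 * ((B⁻¹ * N) 0 0 * (B⁻¹ * N) 0 1)) * a2 / 2
    - (Real.sinh (dist (geod B f) q) * Real.exp (-f)) / 2 * b1

/-- A geodesic facing both `B` and one of its neighbours is far from every point of `B` that is
close to the foot of that neighbour. -/
theorem two_le_of_three_facing {B A N : SL(2, ℝ)} (hA : Facing B A) (hN : Facing B N)
    (hAN : Facing A N) {f : ℝ} {q : ℍ}
    (ho : IsCommonOrthogonal (line B) (line N) (geod B f) q) (t u : ℝ) :
    2 ≤ Real.sinh (dist (geod B f) q) * Real.exp |t - f| *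
      Real.sinh (dist (geod B t) (geod A u)) := by
  obtain ⟨b1, b2, -, hS⟩ := hN.orthogonal ho
  obtain ⟨-, -, p1, p2, -⟩ := hA.entries
  have hs := abs_side_le_sinh_dist B A t u
  rw [side_geod', abs_neg] at hs
  have hs := (le_abs_self _).trans hs
  have hg := gram_add_mul B A N
  have g1 := hA.one_le_gram
  have g2 := hN.one_le_gram
  have g3 := hAN.one_le_gram
  have g4 : 1 ≤ gram B A * gram B N := one_le_mul_of_one_le_of_one_le g1 g2
  have hE : 0 < Real.exp |t - f| := Real.exp_pos _
  calc (2 : ℝ) ≤ Real.sinh (dist (geod B f) q) * ((B⁻¹ * A) 1 0 * (B⁻¹ * A) 1 1 * Real.exp f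
        + (B⁻¹ * A) 0 0 * (B⁻¹ * A) 0 1 * Real.exp (-f)) := by
        have : (2 : ℝ) ≤ gram A N + gram B A * gram B N := by linarith
        rw [hg] at this
        refine this.trans (le_of_eq ?_)
        linear_combination ((B⁻¹ * A) 0 0 * (B⁻¹ * A) 0 1) * b2
          + ((B⁻¹ * A) 1 0 * (B⁻¹ * A) 1 1) * b1
    _ ≤ Real.sinh (dist (geod B f) q) * (Real.exp |t - f| * ((B⁻¹ * A) 1 0 * (B⁻¹ * A) 1 1 *
        Real.exp t + (B⁻¹ * A) 0 0 * (B⁻¹ * A) 0 1 * Real.exp (-t))) := by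
        gcongr
        have e1 : Real.exp f ≤ Real.exp |t - f| * Real.exp t := by
          rw [← Real.exp_add]; apply Real.exp_le_exp.2; linarith [neg_abs_le (t - f)]
        have e2 : Real.exp (-f) ≤ Real.exp |t - f| * Real.exp (-t) := by
          rw [← Real.exp_add]; apply Real.exp_le_exp.2; linarith [le_abs_self (t - f)]
        linarith [mul_le_mul_of_nonneg_left e1 p1, mul_le_mul_of_nonneg_left e2 p2]
    _ ≤ _ := by
        rw [← mul_assoc]
        gcongr

/-- The distance to a neighbouring geodesic at distance `|t - f|` from the foot. -/
theorem sinh_mul_cosh_le {B A : SL(2, ℝ)} (hA : Facing B A) {f : ℝ} {q : ℍ}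
    (ho : IsCommonOrthogonal (line B) (line A) (geod B f) q) (t u : ℝ) :
    Real.sinh (dist (geod B f) q) * Real.cosh (t - f) ≤
      Real.sinh (dist (geod B t) (geod A u)) := by
  obtain ⟨b1, b2, -, hS⟩ := hA.orthogonal ho
  have hs := abs_side_le_sinh_dist B A t u
  rw [side_geod', abs_neg] at hs
  refine le_trans (le_of_eq ?_) ((le_abs_self _).trans hs)
  have s1 : ∀ x y : ℝ, Real.exp (x - y) = Real.exp x * Real.exp (-y) := fun x y => by
    rw [← Real.exp_add]; ring_nf
  rw [Real.cosh_eq, neg_sub, s1, s1]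
  linear_combination -Real.exp t / 2 * b2 - Real.exp (-t) / 2 * b1

/-- Crossing from a geodesic to a facing one changes the position relative to the feet of the
common orthogonal by at most the distance travelled. -/
theorem abs_foot_add_le {B A : SL(2, ℝ)} (hA : Facing B A) {f g : ℝ} {q r : ℍ}
    (ho : IsCommonOrthogonal (line B) (line A) (geod B f) q)
    (ho' : IsCommonOrthogonal (line A) (line B) (geod A g) r) (t u : ℝ) :
    |(t - f) + (u - g)| ≤ dist (geod B t) (geod A u) := by
  obtain ⟨a1, a2, a3, a4⟩ := hA.orthogonal ho
  obtain ⟨b1, b2, b3, b4⟩ := hA.symm.orthogonal ho'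
  obtain ⟨h1, h2, h3, h4⟩ := inv_mul_entries B A
  rw [gram_comm, a3] at b3
  have hD : dist (geod A g) r = dist (geod B f) q :=
    (cosh_inj_nonneg dist_nonneg dist_nonneg b3).symm
  have hS2 := Real.sinh_sq (dist (geod B f) q)
  rw [← a3, gram] at hS2
  rw [hD, h1, h2] at b1
  rw [← abs_of_nonneg (dist_nonneg (x := geod B t)), ← Real.cosh_le_cosh, cosh_dist_geod]
  have hdet := det_entries (B⁻¹ * A)
  have e5 := hA.entries.2.2.2.2
  generalize Real.sinh (dist (geod B f) q) = S at *
  generalize (B⁻¹ * A) 0 0 = a at *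
  generalize (B⁻¹ * A) 0 1 = b at *
  generalize (B⁻¹ * A) 1 0 = c at *
  generalize (B⁻¹ * A) 1 1 = d at *
  have hS : S ^ 2 = 4 * (a * b * c * d) := by
    rw [hS2]; linear_combination ((a * d - b * c) + 1) * hdet
  have hbc : -b = c * Real.exp (f + g) := by
    have h6 : (4 * (a * b * d)) * (-b - c * Real.exp (f + g)) = 0 := by
      rw [Real.exp_add]
      linear_combination (2 * (d * -b)) * a1 + S * Real.exp f * b1
        + Real.exp f * Real.exp g * hS
    rcases mul_eq_zero.1 h6 with h7 | h7
    · have : S ^ 2 = 0 := by rw [hS]; linear_combination c * h7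
      nlinarith
    · linarith
  have k1 : b ^ 2 = -(b * c) * Real.exp (f + g) := by linear_combination -b * hbc
  have k2 : c ^ 2 = -(b * c) * Real.exp (-(f + g)) := by
    have : Real.exp (f + g) * Real.exp (-(f + g)) = 1 := by rw [← Real.exp_add]; simp
    linear_combination - c ^ 2 * this - c * Real.exp (-(f + g)) * hbc
  rw [k1, k2, Real.cosh_eq]
  have n1 : Real.exp (f + g) * Real.exp (-t - u) = Real.exp (-(t - f + (u - g))) := by
    rw [← Real.exp_add]; ring_nf
  have n2 : Real.exp (-(f + g)) * Real.exp (t + u) = Real.exp (t - f + (u - g)) := by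
    rw [← Real.exp_add]; ring_nf
  rw [mul_assoc (-(b * c)), mul_assoc (-(b * c)), n1, n2]
  have l1 : 0 ≤ a ^ 2 * Real.exp (u - t) := by positivity
  have l2 : 0 ≤ d ^ 2 * Real.exp (t - u) := by positivity
  have l3 := Real.exp_pos (-(t - f + (u - g)))
  have l4 := Real.exp_pos (t - f + (u - g))
  nlinarith

/-! ### Right-angled hexagons with long alternating sides -/

/-- The cosine rules at three alternating sides `h₀, h₁, h₂` of a right-angled hexagon imply the
dual cosine rule, which computes the side `u` opposite to `h₂` from them. -/
theorem hexagon_dual {u v w h₀ h₁ h₂ : ℝ} (hu : 0 < Real.sinh u) (hv : 0 < Real.sinh v)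
    (hw : 0 < Real.sinh w) (h0 : 0 < h₀) (h1 : 0 < h₁)
    (e0 : Real.sinh u * Real.sinh v * Real.cosh h₀ = Real.cosh w + Real.cosh u * Real.cosh v)
    (e1 : Real.sinh u * Real.sinh w * Real.cosh h₁ = Real.cosh v + Real.cosh u * Real.cosh w)
    (e2 : Real.sinh v * Real.sinh w * Real.cosh h₂ = Real.cosh u + Real.cosh v * Real.cosh w) :
    Real.cosh u * (Real.sinh h₀ * Real.sinh h₁) =
      Real.cosh h₂ + Real.cosh h₀ * Real.cosh h₁ := by
  have s0 := Real.sinh_pos_iff.2 h0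
  have s1 := Real.sinh_pos_iff.2 h1
  have q0 := Real.sinh_sq h₀
  have q1 := Real.sinh_sq h₁
  have qu := Real.sinh_sq u
  have qv := Real.sinh_sq v
  have qw := Real.sinh_sq w
  generalize Real.sinh h₀ = S0 at *
  generalize Real.sinh h₁ = S1 at *
  generalize Real.cosh h₀ = C0 at *
  generalize Real.cosh h₁ = C1 at *
  generalize Real.cosh h₂ = C2 at *
  generalize Real.sinh u = su at *
  generalize Real.sinh v = sv at *
  generalize Real.sinh w = sw at *
  generalize Real.cosh u = x at *
  generalize Real.cosh v = y at *
  generalize Real.cosh w = z at *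
  -- the common value of the squared numerators of the hyperbolic sines
  have d0 : (su * sv * S0) ^ 2 = x ^ 2 + y ^ 2 + z ^ 2 + 2 * x * y * z - 1 := by
    have : (su * sv * S0) ^ 2 = (su * sv * C0) ^ 2 - su ^ 2 * sv ^ 2 := by
      rw [mul_pow (su * sv), q0]; ring
    rw [this, e0, qu, qv]; ring
  have d1 : (su * sw * S1) ^ 2 = x ^ 2 + y ^ 2 + z ^ 2 + 2 * x * y * z - 1 := by
    have : (su * sw * S1) ^ 2 = (su * sw * C1) ^ 2 - su ^ 2 * sw ^ 2 := by
      rw [mul_pow (su * sw), q1]; ring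
    rw [this, e1, qu, qw]; ring
  have d2 : su * sv * S0 = su * sw * S1 := by
    rw [← sq_eq_sq₀ (by positivity) (by positivity), d0, d1]
  have hne : su ^ 2 * (sv * sw) ≠ 0 := by positivity
  apply mul_left_cancel₀ hne
  have l1 : su ^ 2 * (sv * sw) * (x * (S0 * S1))
      = x * (x ^ 2 + y ^ 2 + z ^ 2 + 2 * x * y * z - 1) := by
    rw [← d0]; linear_combination -x * (su * sv * S0) * d2
  have l2 : su ^ 2 * (sv * sw) * (C2 + C0 * C1)
      = su ^ 2 * (x + y * z) + (z + x * y) * (y + x * z) := by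
    rw [← e0, ← e1, ← e2]; ring
  rw [l1, l2, qu]; ring

/-- A short side of a right-angled hexagon whose long sides are almost `R / 2` is about
`2 * exp (-R / 4)`. Only the lower bound has to be sharp. -/
theorem short_side_bounds {u h₀ h₁ h₂ R θ : ℝ} (hR : 100 ≤ R) (hθ : 0 ≤ θ) (hθ1 : θ ≤ 1 / 20)
    (hu : 0 < Real.sinh u)
    (b0 : |h₀ - R / 2| ≤ θ) (b1 : |h₁ - R / 2| ≤ θ) (b2 : |h₂ - R / 2| ≤ θ)
    (e : Real.cosh u * (Real.sinh h₀ * Real.sinh h₁) =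
      Real.cosh h₂ + Real.cosh h₀ * Real.cosh h₁) :
    2 * Real.exp (-2 * θ) * Real.exp (-R / 4) ≤ Real.sinh u ∧
      Real.sinh u ≤ 4 * Real.exp (-R / 4) := by
  rw [abs_le] at b0 b1 b2
  have p0 : 0 < Real.sinh h₀ := Real.sinh_pos_iff.2 (by linarith)
  have p1 : 0 < Real.sinh h₁ := Real.sinh_pos_iff.2 (by linarith)
  have hd : (Real.cosh u - 1) * (Real.sinh h₀ * Real.sinh h₁)
      = Real.cosh h₂ + Real.cosh (h₀ - h₁) := by
    rw [Real.cosh_sub]; linarith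
  set E := Real.exp (R / 2) with hE
  have hE0 : 0 < E := Real.exp_pos _
  have hE1 : 40 ≤ E := by
    have := Real.add_one_le_exp (R / 2); linarith
  have hE4 : Real.exp (-R / 4) ^ 2 = 1 / E := by
    rw [hE, ← Real.exp_nat_mul, one_div, ← Real.exp_neg]; congr 1; push_cast; ring
  have hexpθ : Real.exp θ ≤ 1.06 := by
    have h1 := Real.exp_bound_div_one_sub_of_interval hθ (by linarith : θ < 1)
    refine h1.trans ?_
    rw [div_le_iff₀ (by linarith)]; linarith
  have hexpθ' : 0.95 ≤ Real.exp (-θ) := by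
    have := Real.add_one_le_exp (-θ); linarith
  -- bounds for the hyperbolic functions of a long side
  have up : ∀ h, R / 2 - θ ≤ h → h ≤ R / 2 + θ → Real.exp h ≤ E * Real.exp θ ∧
      E * Real.exp (-θ) ≤ Real.exp h ∧ Real.exp (-h) ≤ 1 := by
    intro h l r
    refine ⟨?_, ?_, ?_⟩
    · rw [hE, ← Real.exp_add]; exact Real.exp_le_exp.2 r
    · rw [hE, ← Real.exp_add]; exact Real.exp_le_exp.2 (by linarith)
    · exact Real.exp_le_one_iff.2 (by linarith)
  obtain ⟨a1, a2, a3⟩ := up h₀ (by linarith) (by linarith)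
  obtain ⟨c1, c2, c3⟩ := up h₁ (by linarith) (by linarith)
  obtain ⟨d1, d2, d3⟩ := up h₂ (by linarith) (by linarith)
  have hdiff : Real.cosh (h₀ - h₁) ≤ 2 := by
    have : Real.cosh (h₀ - h₁) ≤ Real.cosh 1 := by
      rw [Real.cosh_le_cosh, abs_of_pos (one_pos : (0:ℝ) < 1), abs_le]
      constructor <;> linarith
    refine this.trans ?_
    rw [Real.cosh_eq]
    have e1 := Real.exp_one_lt_d9
    have e2 : Real.exp (-1) ≤ 1 := Real.exp_le_one_iff.2 (by norm_num)
    linarith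
  have hX1 : 0 < Real.cosh u - 1 := by
    by_contra! hc
    have h5 : (Real.cosh u - 1) * (Real.sinh h₀ * Real.sinh h₁) ≤ 0 :=
      mul_nonpos_of_nonpos_of_nonneg hc (by positivity)
    have := Real.cosh_pos h₂
    have := Real.cosh_pos (h₀ - h₁)
    linarith
  have hsq : Real.sinh u ^ 2 = (Real.cosh u - 1) * (Real.cosh u - 1 + 2) := by
    rw [Real.sinh_sq]; ring
  have n0 : 0 < Real.exp (-h₀) := Real.exp_pos _
  have n1 : 0 < Real.exp (-h₁) := Real.exp_pos _
  have n2 : 0 < Real.exp (-h₂) := Real.exp_pos _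
  have t0 := Real.exp_pos θ
  have t1 := Real.exp_pos (-θ)
  constructor
  · -- lower bound
    have hs0 : Real.sinh h₀ ≤ E * Real.exp θ / 2 := by rw [Real.sinh_eq]; linarith
    have hs1 : Real.sinh h₁ ≤ E * Real.exp θ / 2 := by rw [Real.sinh_eq]; linarith
    have hc2 : E * Real.exp (-θ) / 2 ≤ Real.cosh h₂ := by rw [Real.cosh_eq]; linarith
    have h1 : E * Real.exp (-θ) / 2 ≤
        (Real.cosh u - 1) * ((E * Real.exp θ / 2) * (E * Real.exp θ / 2)) := by
      have : Real.sinh h₀ * Real.sinh h₁ ≤ (E * Real.exp θ / 2) * (E * Real.exp θ / 2) := by gcongr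
      have h5 := mul_le_mul_of_nonneg_left this hX1.le
      have := Real.cosh_pos (h₀ - h₁)
      linarith
    have hθθ : Real.exp (-θ) * Real.exp θ = 1 := by rw [← Real.exp_add]; simp
    have h2 : 2 * Real.exp (-θ) ^ 3 * (1 / E) ≤ Real.cosh u - 1 := by
      rw [mul_one_div, div_le_iff₀ hE0]
      have h6 : Real.exp (-θ) ≤ (Real.cosh u - 1) * E * Real.exp θ ^ 2 / 2 := by
        have : E * (Real.exp (-θ)) ≤ E * ((Real.cosh u - 1) * E * Real.exp θ ^ 2 / 2) := by
          linarith
        exact le_of_mul_le_mul_left this hE0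
      have h7 := mul_le_mul_of_nonneg_left h6 (by positivity : 0 ≤ 2 * Real.exp (-θ) ^ 2)
      calc 2 * Real.exp (-θ) ^ 3 = 2 * Real.exp (-θ) ^ 2 * Real.exp (-θ) := by ring
        _ ≤ _ := h7
        _ = (Real.cosh u - 1) * E * (Real.exp (-θ) * Real.exp θ) ^ 2 := by ring
        _ = _ := by rw [hθθ]; ring
    have h2θ : Real.exp (-2 * θ) = Real.exp (-θ) ^ 2 := by
      rw [← Real.exp_nat_mul]; congr 1; push_cast; ring
    apply le_of_sq_le_sq _ hu.le
    rw [h2θ, mul_pow _ (Real.exp (-R / 4)), hE4, hsq]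
    have h8 : Real.exp (-θ) ≤ 1 := Real.exp_le_one_iff.2 (by linarith)
    have h9 : (2 * Real.exp (-θ) ^ 3 * (1 / E)) * Real.exp (-θ)
        ≤ 2 * Real.exp (-θ) ^ 3 * (1 / E) := mul_le_of_le_one_right (by positivity) h8
    have h10 : (2 * Real.exp (-θ) ^ 2) ^ 2 * (1 / E)
        = 2 * ((2 * Real.exp (-θ) ^ 3 * (1 / E)) * Real.exp (-θ)) := by ring
    rw [h10]
    linarith [mul_pos hX1 hX1]
  · -- upper bound
    have hs : ∀ h, E * Real.exp (-θ) ≤ Real.exp h → Real.exp (-h) ≤ 1 →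
        0.45 * E ≤ Real.sinh h := by
      intro h l r
      rw [Real.sinh_eq]
      have := mul_le_mul_of_nonneg_left hexpθ' hE0.le
      linarith
    have hs0 := hs h₀ a2 a3
    have hs1 := hs h₁ c2 c3
    have hc2 : Real.cosh h₂ ≤ 0.55 * E := by
      have := mul_le_mul_of_nonneg_left hexpθ hE0.le
      rw [Real.cosh_eq]; linarith
    have h1 : (Real.cosh u - 1) * ((0.45 * E) * (0.45 * E)) ≤ 0.6 * E := by
      have : (0.45 * E) * (0.45 * E) ≤ Real.sinh h₀ * Real.sinh h₁ := by gcongr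
      have h5 := mul_le_mul_of_nonneg_left this hX1.le
      linarith
    have h2 : Real.cosh u - 1 ≤ 3 * (1 / E) := by
      rw [mul_one_div, le_div_iff₀ hE0]
      have : E * ((Real.cosh u - 1) * E * 0.2025) ≤ E * 0.6 := by linarith
      have := le_of_mul_le_mul_left this hE0
      linarith
    have h3 : 1 / E ≤ 1 / 40 := one_div_le_one_div_of_le (by norm_num) hE1
    apply le_of_sq_le_sq _ (by positivity)
    rw [mul_pow, hE4, hsq]
    have h9 : 0 < 1 / E := by positivity
    calc (Real.cosh u - 1) * (Real.cosh u - 1 + 2) ≤ (3 * (1 / E)) * (3 * (1 / 40) + 2) := by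
          apply mul_le_mul h2 _ (by linarith) (by linarith)
          linarith
      _ ≤ _ := by linarith

/-! ### Regions cut out by the lifts -/

theorem continuous_geod (B : SL(2, ℝ)) : Continuous (geod B) :=
  (Isometry.of_dist_eq fun t u => by rw [dist_geod_self, Real.dist_eq]).continuous

theorem translate_line (g B : SL(2, ℝ)) : translate g (line B) = line (g * B) := by
  rw [translate, line, line, ← Set.range_comp]
  congr 1
  ext1 t
  exact mul_smul_geod g B t

theorem translate_mul (g h : SL(2, ℝ)) (X : Set ℍ) :
    translate (g * h) X = translate g (translate h X) := by
  simp [translate, Set.image_image, mul_smul]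

theorem translate_one (X : Set ℍ) : translate 1 X = X := by simp [translate]

theorem translate_inv_translate (g : SL(2, ℝ)) (X : Set ℍ) :
    translate g⁻¹ (translate g X) = X := by rw [← translate_mul]; simp [translate_one]

theorem translate_translate_inv (g : SL(2, ℝ)) (X : Set ℍ) :
    translate g (translate g⁻¹ X) = X := by rw [← translate_mul]; simp [translate_one]

theorem translate_mono (g : SL(2, ℝ)) {X Y : Set ℍ} (h : X ⊆ Y) : translate g X ⊆ translate g Y :=
  Set.image_mono h

theorem mem_translate {g : SL(2, ℝ)} {X : Set ℍ} {z : ℍ} : z ∈ translate g X ↔ g⁻¹ • z ∈ X := by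
  constructor
  · rintro ⟨w, hw, rfl⟩; simpa using hw
  · intro h; exact ⟨_, h, by simp⟩

theorem translate_closure (g : SL(2, ℝ)) (X : Set ℍ) :
    translate g (closure X) = closure (translate g X) :=
  (Homeomorph.smul g).image_closure X

/-- A connected set disjoint from a geodesic lies on one side of it. -/
theorem side_mul_pos {B : SL(2, ℝ)} {s : Set ℍ} (hs : IsPreconnected s) (hd : Disjoint s (line B))
    {p r : ℍ} (hp : p ∈ s) (hr : r ∈ s) : 0 < side B p * side B r := by
  have hne : ∀ x ∈ s, side B x ≠ 0 := fun x hx h0 =>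
    Set.disjoint_left.1 hd hx (mem_line.2 h0)
  have hc := (continuous_side B).continuousOn (s := s)
  by_contra! h
  rcases mul_nonpos_iff.1 h with ⟨h1, h2⟩ | ⟨h1, h2⟩
  · obtain ⟨x, hx, h0⟩ := hs.intermediate_value hr hp hc ⟨h2, h1⟩
    exact hne x hx h0
  · obtain ⟨x, hx, h0⟩ := hs.intermediate_value hp hr hc ⟨h1, h2⟩
    exact hne x hx h0

theorem isPreconnected_line (B : SL(2, ℝ)) : IsPreconnected (line B) :=
  isPreconnected_range (continuous_geod B)

theorem mul_pos_trans {x y z : ℝ} (h1 : 0 < x * y) (h2 : 0 < y * z) : 0 < x * z := by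
  have h3 : 0 < (x * y) * (y * z) := mul_pos h1 h2
  have : (x * y) * (y * z) = y ^ 2 * (x * z) := by ring
  rw [this] at h3
  exact pos_of_mul_pos_right h3 (sq_nonneg y)

/-- Half-planes are convex. -/
theorem side_mul_pos_of_segment {B A : SL(2, ℝ)} {u t v : ℝ} (hut : u ≤ t) (htv : t < v)
    (hu : side B (geod A u) ≠ 0) (huv : 0 ≤ side B (geod A u) * side B (geod A v)) :
    0 < side B (geod A u) * side B (geod A t) := by
  have h := side_interp B A u t v
  have h1 : 0 < Real.sinh (v - t) := Real.sinh_pos_iff.2 (by linarith)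
  have h2 : 0 ≤ Real.sinh (t - u) := Real.sinh_nonneg_iff.2 (by linarith)
  have h3 : 0 < Real.sinh (v - u) := Real.sinh_pos_iff.2 (by linarith)
  generalize side B (geod A u) = x at *
  generalize side B (geod A t) = y at *
  generalize side B (geod A v) = w at *
  have h4 : 0 < Real.sinh (v - u) * (x * y) := by
    have : Real.sinh (v - u) * (x * y) =
        Real.sinh (v - t) * x ^ 2 + Real.sinh (t - u) * (x * w) := by
      linear_combination x * h
    rw [this]
    have : 0 < x ^ 2 := by positivity
    positivity
  exact pos_of_mul_pos_right h4 h3.le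

/-- No geodesic of the family `𝓛` separates `z` and `w`, or contains one of them. -/
def SameSides (𝓛 : Set (Set ℍ)) (z w : ℍ) : Prop :=
  ∀ B : SL(2, ℝ), line B ∈ 𝓛 → 0 < side B z * side B w

theorem SameSides.symm {𝓛 : Set (Set ℍ)} {z w : ℍ} (h : SameSides 𝓛 z w) : SameSides 𝓛 w z :=
  fun B hB => by rw [mul_comm]; exact h B hB

theorem SameSides.trans {𝓛 : Set (Set ℍ)} {z w v : ℍ} (h : SameSides 𝓛 z w)
    (h' : SameSides 𝓛 w v) : SameSides 𝓛 z v :=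
  fun B hB => mul_pos_trans (h B hB) (h' B hB)

variable {G : Subgroup SL(2, ℝ)} {𝓛 : Set (Set ℍ)}

theorem IsLiftedMulticurve.exists_line (hm : IsLiftedMulticurve G 𝓛) {L : Set ℍ} (hL : L ∈ 𝓛) :
    ∃ B, L = line B := by
  obtain ⟨B, g, -, ℓ, h, -⟩ := hm.closed_geodesic L hL
  exact ⟨B, h⟩

/-- The components of the complement of the lifts are intersections of half-planes. -/
theorem mem_component_iff (hm : IsLiftedMulticurve G 𝓛) {z w : ℍ} (hz : z ∈ (⋃₀ 𝓛)ᶜ) :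
    w ∈ connectedComponentIn (⋃₀ 𝓛)ᶜ z ↔ SameSides 𝓛 z w := by
  constructor
  · intro hw B hB
    apply side_mul_pos isPreconnected_connectedComponentIn _ (mem_connectedComponentIn hz) hw
    refine Set.disjoint_left.2 fun x hx hxB => ?_
    exact connectedComponentIn_subset _ _ hx ⟨_, hB, hxB⟩
  · intro h
    obtain ⟨A, T, hT, h0, h1⟩ := exists_geod z w
    have hpre : IsPreconnected (geod A '' Set.Icc 0 T) :=
      isPreconnected_Icc.image _ (continuous_geod A).continuousOn
    refine hpre.subset_connectedComponentIn (x := z) ⟨0, by simp [hT], h0⟩ ?_ ⟨T, by simp [hT], h1⟩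
    rintro _ ⟨t, ht, rfl⟩ ⟨L, hL, htL⟩
    obtain ⟨B, rfl⟩ := hm.exists_line hL
    have hzw := h B hL
    rw [← h0, ← h1] at hzw
    rcases ht.2.eq_or_lt with h2 | h2
    · rw [← h2, mem_line.1 htL] at hzw; simp at hzw
    · have := side_mul_pos_of_segment ht.1 h2 (left_ne_zero_of_mul hzw.ne') hzw.le
      rw [mem_line.1 htL] at this
      simp at this

theorem SameSides.smul (hm : IsLiftedMulticurve G 𝓛) {z w : ℍ} {g : SL(2, ℝ)} (hg : g ∈ G)
    (h : SameSides 𝓛 z w) : SameSides 𝓛 (g • z) (g • w) := by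
  intro B hB
  have h1 : line (g⁻¹ * B) ∈ 𝓛 := by
    rw [← translate_line]; exact hm.invariant _ (inv_mem hg) _ hB
  have := h _ h1
  rwa [← side_mul g, ← side_mul g (g⁻¹ * B), mul_inv_cancel_left] at this

/-- Each geodesic of `𝓛` lies on one side of every other one. -/
theorem side_mul_pos_of_mem_line (hm : IsLiftedMulticurve G 𝓛) {L : Set ℍ} (hL : L ∈ 𝓛)
    {B : SL(2, ℝ)} (hB : line B ∈ 𝓛) (hne : L ≠ line B) {p r : ℍ} (hp : p ∈ L) (hr : r ∈ L) :
    0 < side B p * side B r := by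
  obtain ⟨A, rfl⟩ := hm.exists_line hL
  exact side_mul_pos (isPreconnected_line A) (hm.pairwise_disjoint _ hL _ hB hne) hp hr

theorem MarkedPants.region_subset (P : MarkedPants G 𝓛) : P.region ⊆ (⋃₀ 𝓛)ᶜ := by
  obtain ⟨z, hz, h⟩ := P.region_eq
  rw [h]
  exact connectedComponentIn_subset _ _

theorem MarkedPants.mem_region_iff (hm : IsLiftedMulticurve G 𝓛) (P : MarkedPants G 𝓛) {z w : ℍ}
    (hz : z ∈ P.region) : w ∈ P.region ↔ SameSides 𝓛 z w := by
  have hz' := P.region_subset hz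
  obtain ⟨z', hz'', h⟩ := P.region_eq
  rw [h] at hz ⊢
  rw [connectedComponentIn_eq hz]
  exact mem_component_iff hm hz'

theorem MarkedPants.region_nonempty (P : MarkedPants G 𝓛) : P.region.Nonempty := by
  obtain ⟨z, hz, h⟩ := P.region_eq
  exact ⟨z, h ▸ mem_connectedComponentIn hz⟩

theorem MarkedPants.region_subset_leftSide (hm : IsLiftedMulticurve G 𝓛) (P : MarkedPants G 𝓛)
    {B : SL(2, ℝ)} (hB : line B ∈ 𝓛) {z : ℍ} (hz : z ∈ P.region) (hl : z ∈ leftSide B) :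
    P.region ⊆ leftSide B := by
  intro w hw
  have := (P.mem_region_iff hm hz).1 hw B hB
  rw [mem_leftSide] at *
  exact neg_of_mul_pos_right this hl.le

/-- The geodesics of `𝓛` can be oriented to have a given region on their left. -/
theorem MarkedPants.exists_orientation (hm : IsLiftedMulticurve G 𝓛) (P : MarkedPants G 𝓛)
    {L : Set ℍ} (hL : L ∈ 𝓛) : ∃ B, L = line B ∧ P.region ⊆ leftSide B := by
  obtain ⟨z, hz⟩ := P.region_nonempty
  obtain ⟨B, rfl⟩ := hm.exists_line hL
  have h0 : side B z ≠ 0 := fun h => P.region_subset hz ⟨_, hL, mem_line.2 h⟩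
  rcases lt_or_gt_of_ne h0 with h | h
  · exact ⟨B, rfl, P.region_subset_leftSide hm hL hz (mem_leftSide.2 h)⟩
  · refine ⟨rev B, (line_rev B).symm, P.region_subset_leftSide hm ?_ hz (mem_leftSide.2 ?_)⟩
    · rwa [line_rev]
    · rw [side_rev]; linarith

theorem MarkedPants.side_mul_nonneg (hm : IsLiftedMulticurve G 𝓛) (P : MarkedPants G 𝓛)
    {z p : ℍ} (hz : z ∈ P.region) (hp : p ∈ closure P.region) {B : SL(2, ℝ)} (hB : line B ∈ 𝓛) :
    0 ≤ side B z * side B p := by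
  have hcl : IsClosed {w : ℍ | 0 ≤ side B z * side B w} :=
    isClosed_le continuous_const ((continuous_side B).const_mul _)
  refine closure_minimal (fun w hw => ?_) hcl hp
  exact ((P.mem_region_iff hm hz).1 hw B hB).le

/-- A point of the region and a point of a boundary geodesic are on the same side of every
other geodesic of `𝓛`. -/
theorem MarkedPants.side_mul_pos (hm : IsLiftedMulticurve G 𝓛) (P : MarkedPants G 𝓛)
    {z p : ℍ} (hz : z ∈ P.region) (hp : p ∈ closure P.region) {L : Set ℍ} (hL : L ∈ 𝓛)
    (hpL : p ∈ L) {B : SL(2, ℝ)} (hB : line B ∈ 𝓛) (hne : L ≠ line B) :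
    0 < side B z * side B p := by
  refine (P.side_mul_nonneg hm hz hp hB).lt_of_ne' (mul_ne_zero ?_ ?_)
  · exact fun h => P.region_subset hz ⟨_, hB, mem_line.2 h⟩
  · exact fun h => Set.disjoint_left.1 (hm.pairwise_disjoint _ hL _ hB hne) hpL (mem_line.2 h)

/-- A geodesic of `𝓛` that meets the closure of a region belongs to its boundary: the segments
from a point of the region to the points of the geodesic cross no other geodesic. -/
theorem MarkedPants.subset_closure (hm : IsLiftedMulticurve G 𝓛) (P : MarkedPants G 𝓛)
    {p : ℍ} (hp : p ∈ closure P.region) {L : Set ℍ} (hL : L ∈ 𝓛) (hpL : p ∈ L) :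
    L ⊆ closure P.region := by
  intro r hr
  obtain ⟨z, hz⟩ := P.region_nonempty
  obtain ⟨A, T, hT, h0, h1⟩ := exists_geod z r
  have hT' : 0 < T := by
    refine hT.lt_of_ne ?_
    rintro rfl
    rw [h0] at h1
    exact P.region_subset hz ⟨L, hL, by rw [h1]; exact hr⟩
  have hmem : ∀ t ∈ Set.Ico 0 T, geod A t ∈ P.region := by
    intro t ht
    rw [P.mem_region_iff hm hz]
    intro B hB
    rw [← h0]
    apply side_mul_pos_of_segment ht.1 ht.2
    · rw [h0]; exact fun h => P.region_subset hz ⟨_, hB, mem_line.2 h⟩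
    · rw [h0, h1]
      by_cases hne : L = line B
      · have hr0 : side B r = 0 := mem_line.1 (hne ▸ hr)
        rw [hr0, mul_zero]
      · exact (mul_pos_trans (P.side_mul_pos hm hz hp hL hpL hB hne)
          (side_mul_pos_of_mem_line hm hL hB hne hpL hr)).le
  have : T ∈ closure (Set.Ico 0 T) := by rw [closure_Ico hT'.ne]; simp [hT]
  rw [← h1]
  exact map_mem_closure (continuous_geod A) this hmem

theorem MarkedPants.facing (hm : IsLiftedMulticurve G 𝓛) (P : MarkedPants G 𝓛) {B A : SL(2, ℝ)}
    (hB : line B ∈ 𝓛) (hA : line A ∈ 𝓛) (hne : line B ≠ line A)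
    (hBc : line B ⊆ closure P.region) (hAc : line A ⊆ closure P.region)
    (hBl : P.region ⊆ leftSide B) (hAl : P.region ⊆ leftSide A) : Facing B A := by
  obtain ⟨z, hz⟩ := P.region_nonempty
  constructor
  · intro p hp
    have h1 := P.side_mul_pos hm hz (hAc hp) hA hp hB hne.symm
    have h2 := mem_leftSide.1 (hBl hz)
    rw [mem_leftSide]
    exact neg_of_mul_pos_right h1 h2.le
  · intro p hp
    have h1 := P.side_mul_pos hm hz (hBc hp) hB hp hA hne
    have h2 := mem_leftSide.1 (hAl hz)
    rw [mem_leftSide]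
    exact neg_of_mul_pos_right h1 h2.le

theorem MarkedPants.translate_region (hm : IsLiftedMulticurve G 𝓛) (P : MarkedPants G 𝓛)
    {g : SL(2, ℝ)} (hg : g ∈ G) {z : ℍ} (hz : z ∈ P.region) (h : SameSides 𝓛 z (g • z)) :
    translate g P.region = P.region := by
  ext w
  rw [mem_translate, P.mem_region_iff hm hz, P.mem_region_iff hm hz]
  constructor
  · intro hw
    have := hw.smul hm hg
    rw [smul_inv_smul] at this
    exact h.trans this
  · intro hw
    have := (h.symm.trans hw).smul hm (inv_mem hg)
    rwa [inv_smul_smul] at this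

theorem TranslatesAlong.line_eq {c B : SL(2, ℝ)} {ℓ : ℝ} (h : TranslatesAlong c B ℓ) :
    translate c (line B) = line B := by
  ext z
  constructor
  · rintro ⟨_, ⟨t, rfl⟩, rfl⟩; exact ⟨_, (h.2 t).symm⟩
  · rintro ⟨t, rfl⟩
    exact ⟨geod B (t - ℓ), geod_mem_line _ _, by simp only [h.2]; simp⟩

/-- A translation preserves the sides of its axis. -/
theorem TranslatesAlong.side_smul {c B : SL(2, ℝ)} {ℓ : ℝ} (h : TranslatesAlong c B ℓ) (z : ℍ) :
    side B (c • z) = side B z := by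
  have h1 : line (c * B) = line B := by rw [← translate_line, h.line_eq]
  have hg : ∀ t, geod (c * B) t = geod B (t + ℓ) := fun t => by rw [← mul_smul_geod, h.2]
  rw [← side_mul c B z]
  rcases line_eq_cases h1 with ⟨_, _, h2⟩ | ⟨k, h2, _⟩
  · exact (h2 _).symm
  · have e0 := geod_injective B ((hg 0).symm.trans (h2 0))
    have e1 := geod_injective B ((hg 1).symm.trans (h2 1))
    linarith

/-- A covering transformation along a boundary geodesic preserves the region. -/
theorem MarkedPants.translate_region_of_translatesAlong (hm : IsLiftedMulticurve G 𝓛)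
    (P : MarkedPants G 𝓛) {c B : SL(2, ℝ)} {ℓ : ℝ} (hc : c ∈ G) (h : TranslatesAlong c B ℓ)
    (hB : line B ∈ 𝓛) (hBc : line B ⊆ closure P.region) : translate c P.region = P.region := by
  obtain ⟨z, hz⟩ := P.region_nonempty
  refine P.translate_region hm hc hz fun A hA => ?_
  by_cases hne : line B = line A
  · rw [side_mul_side_of_line_eq hne.symm, h.side_smul]
    have : side B z ≠ 0 := fun h => P.region_subset hz ⟨_, hB, mem_line.2 h⟩
    exact mul_self_pos.2 this
  · have hp := geod_mem_line B 0
    have hcp : c • geod B 0 ∈ line B := by rw [h.2]; exact geod_mem_line _ _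
    have h1 := P.side_mul_pos hm hz (hBc hp) hB hp hA hne
    have h2 := side_mul_pos_of_mem_line hm hB hA hne hp hcp
    have hA' : line (c⁻¹ * A) ∈ 𝓛 := by
      rw [← translate_line]; exact hm.invariant _ (inv_mem hc) _ hA
    have hne' : line B ≠ line (c⁻¹ * A) := by
      rw [← translate_line]
      intro h3
      apply hne
      rw [← h.line_eq, h3, translate_translate_inv]
    have h3 := P.side_mul_pos hm hz (hBc hp) hB hp hA' hne'
    rw [← side_mul c, ← side_mul c (c⁻¹ * A), mul_inv_cancel_left] at h3
    exact mul_pos_trans (mul_pos_trans h1 h2) (mul_comm (side A (c • z)) _ ▸ h3)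

/-! ### Changing the marking of a pair of pants -/

theorem translate_neg (g : SL(2, ℝ)) (X : Set ℍ) : translate (-g) X = translate g X := by
  have : ∀ z : ℍ, (-g) • z = g • z := by
    intro z
    apply UpperHalfPlane.ext
    apply Complex.ext
    · change ((-g) • z).re = (g • z).re
      rw [(smul_re_im _ _).1, (smul_re_im _ _).1]; simp
      congr 1; ring
    · change ((-g) • z).im = (g • z).im
      rw [(smul_re_im _ _).2, (smul_re_im _ _).2]; simp
      congr 1; ring
  simp [translate, this]

theorem translate_stab_mul {g h : SL(2, ℝ)} {X : Set ℍ} (hg : translate g X = X)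
    (hh : translate h X = X) : translate (g * h) X = X := by rw [translate_mul, hh, hg]

theorem translate_stab_inv {g : SL(2, ℝ)} {X : Set ℍ} (hg : translate g X = X) :
    translate g⁻¹ X = X := by
  conv_lhs => rw [← hg]
  exact translate_inv_translate g X

theorem translate_stab_zpow {g : SL(2, ℝ)} {X : Set ℍ} (hg : translate g X = X) (k : ℤ) :
    translate (g ^ k) X = X := by
  induction k using Int.induction_on with
  | zero => simp [translate_one]
  | succ n ih => rw [zpow_add_one]; exact translate_stab_mul ih hg
  | pred n ih => rw [zpow_sub_one]; exact translate_stab_mul ih (translate_stab_inv hg)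

/-- Another marking of the same region: the cuffs are permuted by `σ` and moved by elements of the
stabilizer of the region, and the loops are conjugated accordingly. -/
def MarkedPants.remark (hm : IsLiftedMulticurve G 𝓛) (P : MarkedPants G 𝓛)
    (σ : Equiv.Perm (Fin 3)) (g : Fin 3 → SL(2, ℝ)) (hg : ∀ i, g i ∈ G)
    (hs : ∀ i, translate (g i) P.region = P.region) (c : Fin 3 → SL(2, ℝ))
    (hc : ∀ i, c i = g i * P.loop (σ i) * (g i)⁻¹)
    (hrel : c 2 * c 1 * c 0 = 1 ∨ c 2 * c 1 * c 0 = -1)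
    (hgen : ∀ h ∈ G, translate h P.region = P.region →
      h ∈ Subgroup.closure (Set.range c ∪ {-1})) : MarkedPants G 𝓛 where
  region := P.region
  cuff i := translate (g i) (P.cuff (σ i))
  loop := c
  region_eq := P.region_eq
  cuff_mem i := hm.invariant _ (hg i) _ (P.cuff_mem _)
  cuff_subset i := by
    have := translate_mono (g i) (P.cuff_subset (σ i))
    rwa [translate_closure, hs] at this
  loop_mem i := by
    rw [hc]; exact mul_mem (mul_mem (hg i) (P.loop_mem _)) (inv_mem (hg i))
  loop_axis i := by
    obtain ⟨B, ℓ, h1, h2, h3, h4⟩ := P.loop_axis (σ i)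
    refine ⟨g i * B, ℓ, by rw [h1, translate_line], fun z hz => ?_, h3, fun t => ?_⟩
    · rw [← hs i, mem_translate] at hz
      have := mem_leftSide.1 (h2 hz)
      rw [mem_leftSide]
      rwa [← side_mul (g i), smul_inv_smul] at this
    · rw [← mul_smul_geod, ← mul_smul_geod, ← h4, hc]
      simp [mul_smul]
  relation := hrel
  generates := hgen
  boundary L hL hLc := by
    obtain ⟨k, ⟨h, hG, hst, hk⟩, huniq⟩ := P.boundary L hL hLc
    refine ⟨σ.symm k, ⟨h * (g (σ.symm k))⁻¹, mul_mem hG (inv_mem (hg _)),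
      translate_stab_mul hst (translate_stab_inv (hs _)), ?_⟩, ?_⟩
    · rw [Equiv.apply_symm_apply, translate_mul, translate_inv_translate, hk]
    · rintro i ⟨h', hG', hst', hi⟩
      rw [Equiv.eq_symm_apply]
      exact huniq _ ⟨h' * g i, mul_mem hG' (hg i), translate_stab_mul hst' (hs i), by
        rw [hi, translate_mul]⟩

theorem mul_comm_of_eq_pm_one {x y : SL(2, ℝ)} (h : x * y = 1 ∨ x * y = -1) :
    y * x = 1 ∨ y * x = -1 := by
  have : y * x = x⁻¹ * (x * y) * x := by group
  rcases h with h | h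
  · left; rw [this, h]; simp
  · right; rw [this, h]; simp

theorem MarkedPants.exists_rotate (hm : IsLiftedMulticurve G 𝓛) (P : MarkedPants G 𝓛) :
    ∃ Q : MarkedPants G 𝓛, Q.region = P.region ∧ ∀ i, Q.cuff i = P.cuff (i + 1) := by
  refine ⟨P.remark hm (Equiv.addRight 1) (fun _ => 1) (fun _ => one_mem _)
    (fun _ => translate_one _) (fun i => P.loop (i + 1)) (fun i => by simp) ?_ ?_, rfl,
    fun i => translate_one _⟩
  · change P.loop 0 * P.loop 2 * P.loop 1 = 1 ∨ P.loop 0 * P.loop 2 * P.loop 1 = -1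
    rw [mul_assoc]
    exact mul_comm_of_eq_pm_one P.relation
  · have : Set.range (fun i => P.loop (i + 1)) = Set.range P.loop :=
      (Equiv.addRight (1 : Fin 3)).surjective.range_comp P.loop
    rw [this]
    exact P.generates

theorem MarkedPants.exists_translate (hm : IsLiftedMulticurve G 𝓛) (P : MarkedPants G 𝓛)
    {g : SL(2, ℝ)} (hg : g ∈ G) (hs : translate g P.region = P.region) :
    ∃ Q : MarkedPants G 𝓛, Q.region = P.region ∧ ∀ i, Q.cuff i = translate g (P.cuff i) := by
  refine ⟨P.remark hm (Equiv.refl _) (fun _ => g) (fun _ => hg) (fun _ => hs)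
    (fun i => g * P.loop i * g⁻¹) (fun i => rfl) ?_ ?_, rfl, fun i => rfl⟩
  · have : g * P.loop 2 * g⁻¹ * (g * P.loop 1 * g⁻¹) * (g * P.loop 0 * g⁻¹)
        = g * (P.loop 2 * P.loop 1 * P.loop 0) * g⁻¹ := by group
    rw [this]
    rcases P.relation with h | h <;> rw [h] <;> simp
  · intro h hG hst
    have h1 := P.generates (g⁻¹ * h * g) (mul_mem (mul_mem (inv_mem hg) hG) hg)
      (translate_stab_mul (translate_stab_mul (translate_stab_inv hs) hst) hs)
    have h2 := Subgroup.mem_map_of_mem (MulAut.conj g).toMonoidHom h1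
    rw [MonoidHom.map_closure] at h2
    have e : (MulAut.conj g).toMonoidHom (g⁻¹ * h * g) = h := by simp [MulAut.conj_apply]; group
    rw [e] at h2
    refine Subgroup.closure_mono ?_ h2
    rintro _ ⟨x, (⟨i, rfl⟩ | hx), rfl⟩
    · left; exact ⟨i, rfl⟩
    · right
      rw [Set.mem_singleton_iff.1 hx]
      simp

theorem MarkedPants.loop_stab (hm : IsLiftedMulticurve G 𝓛) (P : MarkedPants G 𝓛) (i : Fin 3) :
    translate (P.loop i) P.region = P.region := by
  obtain ⟨B, ℓ, h1, -, h3⟩ := P.loop_axis i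
  exact P.translate_region_of_translatesAlong hm (P.loop_mem i) h3 (h1 ▸ P.cuff_mem i)
    (h1 ▸ P.cuff_subset i)

theorem MarkedPants.loop_cuff (P : MarkedPants G 𝓛) (i : Fin 3) :
    translate (P.loop i) (P.cuff i) = P.cuff i := by
  obtain ⟨B, ℓ, h1, -, h3⟩ := P.loop_axis i
  rw [h1, h3.line_eq]

/-- The half twist exchanging the last two boundary components of a marked pair of pants. -/
theorem MarkedPants.exists_flip (hm : IsLiftedMulticurve G 𝓛) (P : MarkedPants G 𝓛) :
    ∃ Q : MarkedPants G 𝓛, Q.region = P.region ∧ Q.cuff 0 = P.cuff 0 ∧ Q.cuff 1 = P.cuff 2 ∧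
      Q.cuff 2 = translate (P.loop 0)⁻¹ (P.cuff 1) := by
  refine ⟨P.remark hm (Equiv.swap 1 2) ![1, 1, P.loop 2] ?_ ?_
    ![P.loop 0, P.loop 2, P.loop 2 * P.loop 1 * (P.loop 2)⁻¹] ?_ ?_ ?_, rfl, ?_, ?_, ?_⟩
  · intro i; fin_cases i
    · exact one_mem _
    · exact one_mem _
    · exact P.loop_mem 2
  · intro i; fin_cases i
    · exact translate_one _
    · exact translate_one _
    · exact P.loop_stab hm 2
  · intro i; fin_cases i
    · have : Equiv.swap (1 : Fin 3) 2 0 = 0 := by decide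
      simp [this]
    · simp
    · simp
  · have := P.relation
    simpa using this
  · intro h hG hst
    have h1 := P.generates h hG hst
    refine (Subgroup.closure_le _).2 ?_ h1
    set c : Fin 3 → SL(2, ℝ) := ![P.loop 0, P.loop 2, P.loop 2 * P.loop 1 * (P.loop 2)⁻¹]
    have m : ∀ i, c i ∈ Subgroup.closure (Set.range c ∪ {-1}) := fun i =>
      Subgroup.subset_closure (Or.inl ⟨i, rfl⟩)
    rintro x (⟨i, rfl⟩ | hx)
    · fin_cases i
      · exact m 0
      · have e : P.loop 1 = (c 1)⁻¹ * c 2 * c 1 := by simp [c]; group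
        change P.loop 1 ∈ _
        rw [e]
        exact mul_mem (mul_mem (inv_mem (m 1)) (m 2)) (m 1)
      · exact m 1
    · exact Subgroup.subset_closure (Or.inr hx)
  · have : Equiv.swap (1 : Fin 3) 2 0 = 0 := by decide
    simp [MarkedPants.remark, this, translate_one]
  · simp [MarkedPants.remark, translate_one]
  · simp only [MarkedPants.remark, Equiv.swap_apply_right]
    change translate (P.loop 2) (P.cuff 1) = _
    conv_lhs => rw [← P.loop_cuff 1, ← translate_mul]
    rcases P.relation with h | h
    · rw [eq_inv_of_mul_eq_one_left h]
    · have : P.loop 2 * P.loop 1 = -(P.loop 0)⁻¹ := by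
        rw [eq_mul_inv_of_mul_eq h]; simp
      rw [this, translate_neg]

/-- Every geodesic in the boundary of a region is a cuff of some marking. -/
theorem MarkedPants.exists_marking (hm : IsLiftedMulticurve G 𝓛) (P : MarkedPants G 𝓛)
    {L : Set ℍ} (hL : L ∈ 𝓛) (hLc : L ⊆ closure P.region) :
    ∃ Q : MarkedPants G 𝓛, Q.region = P.region ∧ Q.cuff 0 = L := by
  obtain ⟨k, ⟨h, hG, hst, hk⟩, -⟩ := P.boundary L hL hLc
  obtain ⟨Q, hQ, hQc⟩ := P.exists_translate hm hG hst
  obtain ⟨Q1, hQ1, hQc1⟩ := Q.exists_rotate hm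
  obtain ⟨Q2, hQ2, hQc2⟩ := Q1.exists_rotate hm
  have e0 : Q.cuff k = L := by rw [hQc, hk]
  fin_cases k
  · exact ⟨Q, hQ, e0⟩
  · exact ⟨Q1, hQ1.trans hQ, by rw [hQc1]; exact e0⟩
  · exact ⟨Q2, hQ2.trans (hQ1.trans hQ), by rw [hQc2, hQc1]; exact e0⟩

theorem MarkedPants.translate_cuff_ne (P : MarkedPants G 𝓛) {i j : Fin 3} (hij : i ≠ j)
    {g : SL(2, ℝ)} (hg : g ∈ G) (hs : translate g P.region = P.region) :
    P.cuff i ≠ translate g (P.cuff j) := by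
  intro h
  obtain ⟨k, -, huniq⟩ := P.boundary _ (P.cuff_mem i) (P.cuff_subset i)
  have h1 := huniq i ⟨1, one_mem _, translate_one _, (translate_one _).symm⟩
  have h2 := huniq j ⟨g, hg, hs, h⟩
  exact hij (h1.trans h2.symm)

theorem IsCommonOrthogonal.smul {L M : Set ℍ} {p q : ℍ} (h : IsCommonOrthogonal L M p q)
    (g : SL(2, ℝ)) : IsCommonOrthogonal (translate g L) (translate g M) (g • p) (g • q) := by
  obtain ⟨h1, h2, h3, h4⟩ := h
  refine ⟨⟨p, h1, rfl⟩, ⟨q, h2, rfl⟩, ?_, ?_⟩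
  · rintro _ ⟨p', hp', rfl⟩
    simpa only [dist_smul] using h3 p' hp'
  · rintro _ ⟨q', hq', rfl⟩
    simpa only [dist_smul] using h4 q' hq'

/-- The common orthogonal of two facing geodesics is unique. -/
theorem Facing.orthogonal_unique {B A : SL(2, ℝ)} (h : Facing B A) {f g : ℝ} {q r : ℍ}
    (ho : IsCommonOrthogonal (line B) (line A) (geod B f) q)
    (ho' : IsCommonOrthogonal (line B) (line A) (geod B g) r) : f = g := by
  obtain ⟨a1, -, a3, a4⟩ := h.orthogonal ho
  obtain ⟨b1, -, b3, b4⟩ := h.orthogonal ho'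
  have hD := cosh_inj_nonneg dist_nonneg dist_nonneg (a3.symm.trans b3)
  rw [← hD, a1] at b1
  exact Real.exp_injective (mul_left_cancel₀ a4.ne' b1)

/-! ### The feet of the common orthogonals on a cuff -/

theorem MarkedPants.cuff_ne (P : MarkedPants G 𝓛) {i j : Fin 3} (hij : i ≠ j) :
    P.cuff i ≠ P.cuff j := by
  have := P.translate_cuff_ne hij (one_mem G) (translate_one _)
  rwa [translate_one] at this

/-- The three cuffs, oriented with the region on the left. -/
theorem MarkedPants.exists_facing (hm : IsLiftedMulticurve G 𝓛) (P : MarkedPants G 𝓛) :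
    ∃ A : Fin 3 → SL(2, ℝ), (∀ i, P.cuff i = line (A i)) ∧ (∀ i, P.region ⊆ leftSide (A i)) ∧
      ∀ i j, i ≠ j → Facing (A i) (A j) := by
  choose A hA hl using fun i => P.exists_orientation hm (P.cuff_mem i)
  refine ⟨A, hA, hl, fun i j hij => P.facing hm ?_ ?_ ?_ ?_ ?_ (hl i) (hl j)⟩
  · rw [← hA]; exact P.cuff_mem i
  · rw [← hA]; exact P.cuff_mem j
  · rw [← hA, ← hA]; exact P.cuff_ne hij
  · rw [← hA]; exact P.cuff_subset i
  · rw [← hA]; exact P.cuff_subset j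

/-- The hexagon equation at one cuff, with the other sides measured by the Gram matrix. -/
theorem hexagon_rule_gram {B A N : SL(2, ℝ)} (hA : Facing B A) (hN : Facing B N)
    {p q p' q' : ℍ} (ho : IsCommonOrthogonal (line B) (line A) p q)
    (ho' : IsCommonOrthogonal (line B) (line N) p' q') :
    (gram B A = Real.cosh (dist p q) ∧ 0 < Real.sinh (dist p q)) ∧
    (gram B N = Real.cosh (dist p' q') ∧ 0 < Real.sinh (dist p' q')) ∧
    Real.sinh (dist p q) * Real.sinh (dist p' q') * Real.cosh (dist p p') =
      gram A N + gram B A * gram B N := by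
  obtain ⟨f, rfl⟩ := ho.1
  obtain ⟨g, rfl⟩ := ho'.1
  rw [dist_geod_self, Real.cosh_abs]
  exact ⟨(hA.orthogonal ho).2.2, (hN.orthogonal ho').2.2, hexagon_rule hA hN ho ho'⟩

/-- The distances from a cuff to the other two are about `2 * exp (-R / 4)`. -/
theorem MarkedPants.short_sides (hm : IsLiftedMulticurve G 𝓛) {hl s : Set ℍ → ℝ}
    (hF : IsFenchelNielsen G 𝓛 hl s) {R θ : ℝ} (hR : 100 ≤ R) (hθ : 0 ≤ θ) (hθ1 : θ ≤ 1 / 20)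
    (hb : ∀ L ∈ 𝓛, |hl L - R / 2| ≤ θ) (P : MarkedPants G 𝓛) {p q : ℍ} {j : Fin 3} (hj : j ≠ 0)
    (ho : IsCommonOrthogonal (P.cuff 0) (P.cuff j) p q) :
    2 * Real.exp (-2 * θ) * Real.exp (-R / 4) ≤ Real.sinh (dist p q) ∧
      Real.sinh (dist p q) ≤ 4 * Real.exp (-R / 4) := by
  obtain ⟨A, hA, -, hface⟩ := P.exists_facing hm
  obtain ⟨p0, q0, p0', q0', o0, o0', l0⟩ := hF.half_length P 0
  obtain ⟨p1, q1, p1', q1', o1, o1', l1⟩ := hF.half_length P 1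
  obtain ⟨p2, q2, p2', q2', o2, o2', l2⟩ := hF.half_length P 2
  have b0 := hb _ (P.cuff_mem 0)
  have b1 := hb _ (P.cuff_mem 1)
  have b2 := hb _ (P.cuff_mem 2)
  rw [l0] at b0
  rw [l1] at b1
  rw [l2] at b2
  have pos : ∀ x, |x - R / 2| ≤ θ → 0 < x := fun x hx => by
    rw [abs_le] at hx; linarith [hx.1]
  rw [show (0 : Fin 3) + 1 = 1 from rfl] at o0
  rw [show (0 : Fin 3) + 2 = 2 from rfl] at o0'
  rw [show (1 : Fin 3) + 1 = 2 from rfl] at o1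
  rw [show (1 : Fin 3) + 2 = 0 from rfl] at o1'
  rw [show (2 : Fin 3) + 1 = 0 from rfl] at o2
  rw [show (2 : Fin 3) + 2 = 1 from rfl] at o2'
  simp only [hA] at o0 o0' o1 o1' o2 o2' ho
  obtain ⟨⟨u1, u2⟩, ⟨v1, v2⟩, e0⟩ :=
    hexagon_rule_gram (hface 0 1 (by decide)) (hface 0 2 (by decide)) o0 o0'
  obtain ⟨⟨w1, w2⟩, ⟨u3, -⟩, e1⟩ :=
    hexagon_rule_gram (hface 1 2 (by decide)) (hface 1 0 (by decide)) o1 o1'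
  obtain ⟨⟨v3, -⟩, ⟨w3, -⟩, e2⟩ :=
    hexagon_rule_gram (hface 2 0 (by decide)) (hface 2 1 (by decide)) o2 o2'
  have du : dist p1' q1' = dist p0 q0 :=
    cosh_inj_nonneg dist_nonneg dist_nonneg (by rw [← u3, ← u1, gram_comm])
  have dv : dist p2 q2 = dist p0' q0' :=
    cosh_inj_nonneg dist_nonneg dist_nonneg (by rw [← v3, ← v1, gram_comm])
  have dw : dist p2' q2' = dist p1 q1 :=
    cosh_inj_nonneg dist_nonneg dist_nonneg (by rw [← w3, ← w1, gram_comm])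
  rw [u1, v1, w1] at e0
  rw [gram_comm (A 0), gram_comm (A 0), u1, v1, w1, du] at e1
  rw [gram_comm (A 0), gram_comm (A 1) (A 2), u1, v1, w1, dv, dw] at e2
  fin_cases j
  · exact absurd rfl hj
  · have d : dist p q = dist p0 q0 := by
      have := (hexagon_rule_gram (hface 0 1 (by decide)) (hface 0 2 (by decide)) ho o0').1.1
      exact cosh_inj_nonneg dist_nonneg dist_nonneg (this.symm.trans u1)
    rw [d]
    exact short_side_bounds hR hθ hθ1 u2 b0 b1 b2
      (hexagon_dual (h₂ := dist p2 p2') u2 v2 w2 (pos _ b0) (pos _ b1) e0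
        (by linarith) (by linarith))
  · have d : dist p q = dist p0' q0' := by
      have := (hexagon_rule_gram (hface 0 1 (by decide)) (hface 0 2 (by decide)) o0 ho).2.1.1
      exact cosh_inj_nonneg dist_nonneg dist_nonneg (this.symm.trans v1)
    rw [d]
    exact short_side_bounds hR hθ hθ1 v2 b0 b2 b1
      (hexagon_dual (h₂ := dist p1 p1') v2 u2 w2 (pos _ b0) (pos _ b2)
        (by linarith) (by linarith) (by linarith))

theorem TranslatesAlong.zpow {c B : SL(2, ℝ)} {ℓ : ℝ} (h : TranslatesAlong c B ℓ) (k : ℤ) (t : ℝ) :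
    c ^ k • geod B t = geod B (t + k * ℓ) := by
  have hi : ∀ t, c⁻¹ • geod B t = geod B (t - ℓ) := fun t => by
    rw [inv_smul_eq_iff, h.2]; simp
  induction k using Int.induction_on generalizing t with
  | zero => simp
  | succ n ih => rw [zpow_add_one, mul_smul, h.2, ih]; congr 1; push_cast; ring
  | pred n ih => rw [zpow_sub_one, mul_smul, hi, ih]; congr 1; push_cast; ring

/-- The first loop of a marking, along any parametrization of the first cuff that has the region
on its left. -/
theorem MarkedPants.translatesAlong (P : MarkedPants G 𝓛) {B : SL(2, ℝ)} (hB : P.cuff 0 = line B)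
    (hBl : P.region ⊆ leftSide B) : ∃ ℓ, TranslatesAlong (P.loop 0) B ℓ := by
  obtain ⟨B', ℓ, h1, h2, h3, h4⟩ := P.loop_axis 0
  obtain ⟨z, hz⟩ := P.region_nonempty
  obtain ⟨c, hc⟩ := geod_eq_of_leftSide (hB.symm.trans h1) (hBl hz) (h2 hz)
  refine ⟨ℓ, h3, fun t => ?_⟩
  rw [hc, h4, hc]
  congr 1; ring

/-- The feet on a cuff are equally spaced: the translation length along the cuff is twice the half
length, and the feet for the two neighbouring cuffs alternate. -/
theorem MarkedPants.foot_spacing (hm : IsLiftedMulticurve G 𝓛) {hl s : Set ℍ → ℝ}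
    (hF : IsFenchelNielsen G 𝓛 hl s) (P : MarkedPants G 𝓛) {B : SL(2, ℝ)}
    (hB : P.cuff 0 = line B) (hBl : P.region ⊆ leftSide B) {t : ℝ} {q : ℍ}
    (ho : IsCommonOrthogonal (P.cuff 0) (P.cuff 2) (geod B t) q) :
    TranslatesAlong (P.loop 0) B (2 * hl (line B)) ∧
      ∃ q', IsCommonOrthogonal (P.cuff 0) (P.cuff 1) (geod B (t + hl (line B))) q' := by
  obtain ⟨ℓ, hℓ⟩ := P.translatesAlong hB hBl
  obtain ⟨A, hA, hAl, hface⟩ := P.exists_facing hm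
  have hBm : line B ∈ 𝓛 := hB ▸ P.cuff_mem 0
  have hfaceB : ∀ j, j ≠ 0 → Facing B (A j) := fun j hj => by
    refine P.facing hm hBm (hA j ▸ P.cuff_mem j) ?_ ?_ (hA j ▸ P.cuff_subset j) hBl (hAl j)
    · rw [← hA, ← hB]; exact P.cuff_ne hj.symm
    · rw [← hB]; exact P.cuff_subset 0
  obtain ⟨p0, q0, p0', q0', o0, o0', l0⟩ := hF.half_length P 0
  rw [show (0 : Fin 3) + 1 = 1 from rfl] at o0
  rw [show (0 : Fin 3) + 2 = 2 from rfl] at o0'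
  obtain ⟨Q, hQ, hQ0, hQ1, hQ2⟩ := P.exists_flip hm
  obtain ⟨p1, q1, p1', q1', o1, o1', l1⟩ := hF.half_length Q 0
  rw [show (0 : Fin 3) + 1 = 1 from rfl, hQ0, hQ1] at o1
  rw [show (0 : Fin 3) + 2 = 2 from rfl, hQ0, hQ2] at o1'
  rw [hQ0] at l1
  -- move the second foot of the flipped marking to the cuff with label one
  have o2 := o1'.smul (P.loop 0)
  rw [P.loop_cuff, translate_translate_inv] at o2
  rw [hB] at o0 o0' o1 o1' o2 ho l0 l1
  rw [hA] at o0 o0' o1 o2 ho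
  obtain ⟨f, rfl⟩ := o0.1
  obtain ⟨f', rfl⟩ := o0'.1
  obtain ⟨g, rfl⟩ := o1.1
  obtain ⟨g', rfl⟩ := o1'.1
  rw [hℓ.2] at o2
  have e1 := (hfaceB 2 (by decide)).orthogonal_unique o0' ho
  have e2 := (hfaceB 2 (by decide)).orthogonal_unique o1 ho
  have e3 := (hfaceB 1 (by decide)).orthogonal_unique o2 o0
  rw [dist_geod_self] at l0 l1
  rw [e1] at l0
  rw [e2] at l1
  have hpos := hℓ.1
  -- `|f - t| = |t - (f - ℓ)| = hl` with `ℓ > 0` leaves one possibility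
  have key : f = t + hl (line B) ∧ ℓ = 2 * hl (line B) := by
    rcases abs_cases (f - t) with ⟨h1, h2⟩ | ⟨h1, h2⟩ <;>
    rcases abs_cases (t - g') with ⟨h3, h4⟩ | ⟨h3, h4⟩ <;>
    constructor <;> linarith
  rw [← key.1, ← key.2]
  refine ⟨hℓ, q0, ?_⟩
  rw [hB, hA]
  exact o0

/-- The neighbours of a cuff in a region: there is one at every foot. -/
theorem MarkedPants.exists_neighbour (hm : IsLiftedMulticurve G 𝓛) {hl s : Set ℍ → ℝ}
    (hF : IsFenchelNielsen G 𝓛 hl s) {R θ : ℝ} (hR : 100 ≤ R) (hθ : 0 ≤ θ) (hθ1 : θ ≤ 1 / 20)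
    (hb : ∀ L ∈ 𝓛, |hl L - R / 2| ≤ θ) (P : MarkedPants G 𝓛) {B : SL(2, ℝ)}
    (hB : P.cuff 0 = line B) (hBl : P.region ⊆ leftSide B) {t : ℝ} {q : ℍ}
    (ho : IsCommonOrthogonal (P.cuff 0) (P.cuff 2) (geod B t) q) (k : ℤ) :
    ∃ A : SL(2, ℝ), line A ∈ 𝓛 ∧ line A ⊆ closure P.region ∧ P.region ⊆ leftSide A ∧
      Facing B A ∧ ∃ r, IsCommonOrthogonal (line B) (line A) (geod B (t + k * hl (line B))) r ∧
      2 * Real.exp (-2 * θ) * Real.exp (-R / 4)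
        ≤ Real.sinh (dist (geod B (t + k * hl (line B))) r) ∧
      Real.sinh (dist (geod B (t + k * hl (line B))) r) ≤ 4 * Real.exp (-R / 4) := by
  obtain ⟨hT, q', ho'⟩ := P.foot_spacing hm hF hB hBl ho
  have hBm : line B ∈ 𝓛 := hB ▸ P.cuff_mem 0
  -- it is enough to translate the neighbours with labels one and two
  have main : ∀ (i : Fin 3) (f : ℝ) (r : ℍ) (j : ℤ), i ≠ 0 → f + j * (2 * hl (line B)) =
      t + k * hl (line B) → IsCommonOrthogonal (P.cuff 0) (P.cuff i) (geod B f) r →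
      ∃ A : SL(2, ℝ), line A ∈ 𝓛 ∧ line A ⊆ closure P.region ∧ P.region ⊆ leftSide A ∧
      Facing B A ∧ ∃ r, IsCommonOrthogonal (line B) (line A) (geod B (t + k * hl (line B))) r ∧
      2 * Real.exp (-2 * θ) * Real.exp (-R / 4)
        ≤ Real.sinh (dist (geod B (t + k * hl (line B))) r) ∧
      Real.sinh (dist (geod B (t + k * hl (line B))) r) ≤ 4 * Real.exp (-R / 4) := by
    intro i f r j hi hf hor
    have hg : P.loop 0 ^ j ∈ G := zpow_mem (P.loop_mem 0) j
    have hs := translate_stab_zpow (P.loop_stab hm 0) j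
    have hs0 := translate_stab_zpow (P.loop_cuff 0) j
    obtain ⟨A, hA, hAl⟩ := P.exists_orientation hm (hm.invariant _ hg _ (P.cuff_mem i))
    have hAm : line A ∈ 𝓛 := hA ▸ hm.invariant _ hg _ (P.cuff_mem i)
    have hAc : line A ⊆ closure P.region := by
      have := translate_mono (P.loop 0 ^ j) (P.cuff_subset i)
      rwa [translate_closure, hs, hA] at this
    have hbd := P.short_sides hm hF hR hθ hθ1 hb hi hor
    have ho2 := hor.smul (P.loop 0 ^ j)
    rw [hs0, hA, hT.zpow, hf, hB] at ho2
    rw [← dist_smul (P.loop 0 ^ j), hT.zpow, hf] at hbd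
    refine ⟨A, hAm, hAc, hAl, P.facing hm hBm hAm ?_ (hB ▸ P.cuff_subset 0) hAc hBl hAl, _,
      ho2, hbd⟩
    rw [← hA, ← hB]
    exact P.translate_cuff_ne hi.symm hg hs
  obtain ⟨j, hj | hj⟩ := Int.even_or_odd' k
  · exact main 2 t q j (by decide) (by rw [hj]; push_cast; ring) ho
  · exact main 1 _ q' j (by decide) (by rw [hj]; push_cast; ring) ho'

/-! ### Crossing the lifts along an arc -/

theorem sinh_three_eighths_lt : Real.sinh (3 / 8) < 0.4 := by
  have h1 := Real.exp_bound_div_one_sub_of_interval (x := 1 / 16) (by norm_num) (by norm_num)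
  have h2 : Real.exp (3 / 8) = Real.exp (1 / 16) ^ 6 := by
    rw [← Real.exp_nat_mul]; norm_num
  have h3 : Real.exp (3 / 8) ≤ 1.473 := by
    rw [h2]
    calc Real.exp (1 / 16) ^ 6 ≤ (1 / (1 - 1 / 16)) ^ 6 := by gcongr
      _ ≤ _ := by norm_num
  have h4 : 0.675 ≤ Real.exp (-(3 / 8)) := by
    rw [Real.exp_neg, le_inv_comm₀ (by norm_num) (Real.exp_pos _)]
    refine h3.trans ?_
    norm_num
  rw [Real.sinh_eq]
  linarith

/-- If a boundary geodesic `line A` of a region passes at distance less than `3 / 8` from a point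
of the cuff `line B`, then it is the neighbour of `line B` at the foot nearest to that point, and
this foot is not too far away. -/
theorem MarkedPants.exists_near_foot (hm : IsLiftedMulticurve G 𝓛) {hl s : Set ℍ → ℝ}
    (hF : IsFenchelNielsen G 𝓛 hl s) {R θ : ℝ} (hR : 100 ≤ R) (hθ : 0 ≤ θ) (hθ1 : θ ≤ 1 / 20)
    (hb : ∀ L ∈ 𝓛, |hl L - R / 2| ≤ θ) (P : MarkedPants G 𝓛) {B A : SL(2, ℝ)}
    (hB : P.cuff 0 = line B) (hBl : P.region ⊆ leftSide B) {t : ℝ} {q : ℍ}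
    (ho : IsCommonOrthogonal (P.cuff 0) (P.cuff 2) (geod B t) q)
    (hA : line A ∈ 𝓛) (hAc : line A ⊆ closure P.region) (hAl : P.region ⊆ leftSide A)
    (hne : line B ≠ line A) {x y : ℝ} (hd : dist (geod B x) (geod A y) < 3 / 8) :
    ∃ (k : ℤ) (r : ℍ), IsCommonOrthogonal (line B) (line A) (geod B (t + k * hl (line B))) r ∧
      |x - (t + k * hl (line B))| ≤ R / 4 - 3 / 4 := by
  have hBm : line B ∈ 𝓛 := hB ▸ P.cuff_mem 0
  have hBc : line B ⊆ closure P.region := hB ▸ P.cuff_subset 0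
  have hlB := abs_le.1 (hb _ hBm)
  have hpos : 0 < hl (line B) := by linarith
  have hsinh : Real.sinh (dist (geod B x) (geod A y)) < 0.4 :=
    (Real.sinh_lt_sinh.2 hd).trans sinh_three_eighths_lt
  have hsinh0 : 0 ≤ Real.sinh (dist (geod B x) (geod A y)) := Real.sinh_nonneg_iff.2 dist_nonneg
  have hBA : Facing B A := P.facing hm hBm hA hne hBc hAc hBl hAl
  set k := round ((x - t) / hl (line B)) with hk
  have hnear : |x - (t + k * hl (line B))| ≤ hl (line B) / 2 := by
    have h1 := abs_sub_round ((x - t) / hl (line B))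
    have h2 : x - (t + k * hl (line B)) = ((x - t) / hl (line B) - k) * hl (line B) := by
      field_simp; ring
    rw [h2, abs_mul, abs_of_pos hpos]
    linarith [mul_le_mul_of_nonneg_right h1 hpos.le]
  obtain ⟨N, hN, hNc, hNl, hBN, r, hor, hlo, hhi⟩ :=
    P.exists_neighbour hm hF hR hθ hθ1 hb hB hBl ho k
  set f := t + k * hl (line B) with hf
  by_cases hAN : line A = line N
  · refine ⟨k, r, hAN ▸ hor, ?_⟩
    -- otherwise the passage is longer, as `sinh (3 / 8) < 0.4 < exp (-0.85)`
    by_contra! hfar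
    have h1 := sinh_mul_cosh_le hBA (hAN ▸ hor) x y
    have h2 : Real.exp |x - f| / 2 ≤ Real.cosh (x - f) := by
      rw [← Real.cosh_abs, Real.cosh_eq]
      linarith [Real.exp_pos (-|x - f|)]
    have h3 : Real.exp (R / 4 - 3 / 4) / 2 ≤ Real.cosh (x - f) := by
      linarith [Real.exp_le_exp.2 hfar.le]
    have h4 : (2 * Real.exp (-2 * θ) * Real.exp (-R / 4)) * (Real.exp (R / 4 - 3 / 4) / 2)
        ≤ Real.sinh (dist (geod B f) r) * Real.cosh (x - f) := by gcongr
    have h5 : (2 * Real.exp (-2 * θ) * Real.exp (-R / 4)) * (Real.exp (R / 4 - 3 / 4) / 2)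
        = Real.exp (-2 * θ - 3 / 4) := by
      have : Real.exp (-2 * θ) * Real.exp (-R / 4) * Real.exp (R / 4 - 3 / 4)
          = Real.exp (-2 * θ - 3 / 4) := by
        rw [← Real.exp_add, ← Real.exp_add]; ring_nf
      linarith
    have h6 : Real.exp (-0.85) ≤ Real.exp (-2 * θ - 3 / 4) :=
      Real.exp_le_exp.2 (by linarith)
    have h7 : 0.42 < Real.exp (-0.85) := by
      have e1 : Real.exp (-0.85) = Real.exp (-1) * Real.exp 0.15 := by
        rw [← Real.exp_add]; norm_num
      have e2 := Real.exp_neg_one_gt_d9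
      have e3 := Real.add_one_le_exp (0.15 : ℝ)
      rw [e1]
      calc (0.42 : ℝ) < 0.3678 * 1.15 := by norm_num
        _ ≤ Real.exp (-1) * Real.exp 0.15 := by
          apply mul_le_mul <;> linarith
    linarith
  · exfalso
    have hANf : Facing A N := P.facing hm hA hN hAN hAc hNc hAl hNl
    have h1 := two_le_of_three_facing hBA hBN hANf hor x y
    have h2 : Real.exp |x - f| ≤ Real.exp (R / 4) * Real.exp (1 / 40) := by
      rw [← Real.exp_add]
      apply Real.exp_le_exp.2
      linarith
    have h3 : Real.exp (1 / 40) ≤ 1.03 := by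
      refine (Real.exp_bound_div_one_sub_of_interval (by norm_num) (by norm_num)).trans ?_
      norm_num
    have h4 : Real.sinh (dist (geod B f) r) * Real.exp |x - f|
        ≤ (4 * Real.exp (-R / 4)) * (Real.exp (R / 4) * 1.03) := by
      have := Real.exp_pos (R / 4)
      gcongr
      exact h2.trans (by gcongr)
    have h5 : Real.exp (-R / 4) * Real.exp (R / 4) = 1 := by rw [← Real.exp_add]; ring_nf; simp
    have h6 : (4 * Real.exp (-R / 4)) * (Real.exp (R / 4) * 1.03) = 4.12 := by
      linear_combination 4.12 * h5
    rw [h6] at h4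
    have h7 : Real.sinh (dist (geod B f) r) * Real.exp |x - f| *
        Real.sinh (dist (geod B x) (geod A y)) ≤ 4.12 * 0.4 := by gcongr
    norm_num at h7
    linarith

/-- Short passages between two boundary geodesics of a region run along a common orthogonal, and
preserve the position relative to its feet up to their length. -/
theorem MarkedPants.exists_near_feet (hm : IsLiftedMulticurve G 𝓛) {hl s : Set ℍ → ℝ}
    (hF : IsFenchelNielsen G 𝓛 hl s) {R θ : ℝ} (hR : 100 ≤ R) (hθ : 0 ≤ θ) (hθ1 : θ ≤ 1 / 20)
    (hb : ∀ L ∈ 𝓛, |hl L - R / 2| ≤ θ) (P Q : MarkedPants G 𝓛) (hPQ : Q.region = P.region)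
    {B A : SL(2, ℝ)} (hB : P.cuff 0 = line B) (hA : Q.cuff 0 = line A)
    (hBl : P.region ⊆ leftSide B) (hAl : P.region ⊆ leftSide A) (hne : line B ≠ line A)
    {t u : ℝ} {q r : ℍ}
    (ho : IsCommonOrthogonal (P.cuff 0) (P.cuff 2) (geod B t) q)
    (ho' : IsCommonOrthogonal (Q.cuff 0) (Q.cuff 2) (geod A u) r)
    {x y : ℝ} (hd : dist (geod B x) (geod A y) < 3 / 8) :
    ∃ k j : ℤ, |x - (t + k * hl (line B))| ≤ R / 4 - 3 / 4 ∧
      |y - (u + j * hl (line A))| ≤ R / 4 - 3 / 4 ∧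
      |(x - (t + k * hl (line B))) + (y - (u + j * hl (line A)))|
        ≤ dist (geod B x) (geod A y) := by
  have hBm : line B ∈ 𝓛 := hB ▸ P.cuff_mem 0
  have hAm : line A ∈ 𝓛 := hA ▸ Q.cuff_mem 0
  have hBc : line B ⊆ closure P.region := hB ▸ P.cuff_subset 0
  have hAc : line A ⊆ closure P.region := hPQ ▸ hA ▸ Q.cuff_subset 0
  obtain ⟨k, v, o1, h1⟩ := P.exists_near_foot hm hF hR hθ hθ1 hb hB hBl ho hAm hAc hAl hne hd
  obtain ⟨j, w, o2, h2⟩ := Q.exists_near_foot hm hF hR hθ hθ1 hb hA (hPQ ▸ hAl) ho' hBm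
    (hPQ ▸ hBc) (hPQ ▸ hBl) hne.symm (dist_comm (geod B x) _ ▸ hd)
  exact ⟨k, j, h1, h2, abs_foot_add_le (P.facing hm hBm hAm hne hBc hAc hBl hAl) o1 o2 x y⟩

/-- Two geodesics of `𝓛` crossed consecutively are cuffs of markings of the region in between. -/
theorem exists_markings_of_gap (hp : IsLiftedPantsDecomposition G 𝓛) {A B D : SL(2, ℝ)} {u v : ℝ}
    (huv : u < v) (hB : line B ∈ 𝓛) (hD : line D ∈ 𝓛) (hu : geod A u ∈ line B)
    (hv : geod A v ∈ line D) (hr : ∀ t, u < t → 0 < side B (geod A t))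
    (hl : ∀ t, t < v → side D (geod A t) < 0)
    (hgap : ∀ t ∈ Set.Ioo u v, geod A t ∈ (⋃₀ 𝓛)ᶜ) :
    ∃ P Q : MarkedPants G 𝓛, Q.region = P.region ∧ P.cuff 0 = line B ∧ Q.cuff 0 = line D ∧
      P.region ⊆ rightSide B ∧ P.region ⊆ leftSide D := by
  have hm := hp.multicurve
  have hmid : (u + v) / 2 ∈ Set.Ioo u v := ⟨by linarith, by linarith⟩
  obtain ⟨P, hP⟩ := hp.pants _ (hgap _ hmid)
  have hmem : ∀ t ∈ Set.Ioo u v, geod A t ∈ P.region := by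
    intro t ht
    rw [P.mem_region_iff hm hP, ← mem_component_iff hm (hgap _ hmid)]
    have hpre : IsPreconnected (geod A '' Set.Ioo u v) :=
      isPreconnected_Ioo.image _ (continuous_geod A).continuousOn
    refine hpre.subset_connectedComponentIn ⟨_, hmid, rfl⟩ ?_ ⟨_, ht, rfl⟩
    rintro _ ⟨t', ht', rfl⟩
    exact hgap t' ht'
  have hcl : ∀ t ∈ Set.Icc u v, geod A t ∈ closure P.region := by
    intro t ht
    rw [← closure_Ioo huv.ne] at ht
    exact map_mem_closure (continuous_geod A) ht hmem
  have hBc := P.subset_closure hm (hcl u ⟨le_rfl, huv.le⟩) hB hu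
  have hDc := P.subset_closure hm (hcl v ⟨huv.le, le_rfl⟩) hD hv
  obtain ⟨P', hP', hP'c⟩ := P.exists_marking hm hB hBc
  obtain ⟨Q', hQ', hQ'c⟩ := P.exists_marking hm hD hDc
  refine ⟨P', Q', hQ'.trans hP'.symm, hP'c, hQ'c, ?_, ?_⟩
  · rw [hP']
    have h1 := P.region_subset_leftSide hm (B := rev B) (by rwa [line_rev]) hP
      (mem_leftSide.2 (by rw [side_rev]; linarith [hr _ hmid.1]))
    intro w hw
    have := mem_leftSide.1 (h1 hw)
    rw [side_rev] at this
    exact mem_rightSide.2 (by linarith)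
  · rw [hP']
    exact P.region_subset_leftSide hm hD hP (mem_leftSide.2 (hl _ hmid.2))

/-- A geodesic arc of length at most one cannot make too many short passages in a row: each
crossing moves it by about `1` relative to the nearest feet. -/
theorem short_passages_le (hp : IsLiftedPantsDecomposition G 𝓛) {hl s : Set ℍ → ℝ}
    (hF : IsFenchelNielsen G 𝓛 hl s) {R θ : ℝ} (hR : 100 ≤ R) (hθ : 0 ≤ θ) (hθ1 : θ ≤ 1 / 20)
    (hb : ∀ L ∈ 𝓛, |hl L - R / 2| ≤ θ) (hs : ∀ L ∈ 𝓛, |s L - 1| ≤ θ)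
    (A : SL(2, ℝ)) (W : ℕ) (τ : ℕ → ℝ) (B : ℕ → SL(2, ℝ))
    (hτ : ∀ n < W, τ n < τ (n + 1)) (hlen : τ W ≤ τ 0 + 1)
    (hB : ∀ n ≤ W, line (B n) ∈ 𝓛) (hB0 : ∀ n ≤ W, geod (B n) 0 = geod A (τ n))
    (hBl : ∀ n ≤ W, ∀ t, t < τ n → side (B n) (geod A t) < 0)
    (hBr : ∀ n ≤ W, ∀ t, τ n < t → 0 < side (B n) (geod A t))
    (hgap : ∀ n < W, ∀ t ∈ Set.Ioo (τ n) (τ (n + 1)), geod A t ∈ (⋃₀ 𝓛)ᶜ)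
    (hshort : ∀ n < W, τ (n + 1) - τ n < 3 / 8) : (W : ℝ) ≤ 0.6 * R + 3 := by
  have hm := hp.multicurve
  have hon : ∀ n ≤ W, geod A (τ n) ∈ line (B n) := fun n hn => hB0 n hn ▸ geod_mem_line _ _
  choose P Q hPQ hPc hQc hPr hQl using fun n (hn : n < W) =>
    exists_markings_of_gap hp (hτ n hn) (hB n hn.le) (hB (n + 1) hn) (hon n hn.le)
      (hon (n + 1) hn) (hBr n hn.le) (hBl (n + 1) hn) (hgap n hn)
  -- the feet on both sides of the geodesics that are crossed
  choose u v q r k hu hv huv using fun m (hm : m + 1 < W) =>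
    hF.twist (B (m + 1)) (Q m (by omega)) (P (m + 1) hm) 0 0 (hQc m (by omega)) (hPc (m + 1) hm)
      (hPQ m (by omega) ▸ hQl m (by omega)) (hPr (m + 1) hm)
  have hne : ∀ n < W, line (B n) ≠ line (B (n + 1)) := by
    intro n hn h
    have h1 := hBr n hn.le _ (hτ n hn)
    have h2 := hon (n + 1) hn
    rw [← h, mem_line] at h2
    linarith
  have hpass : ∀ m (hmW : m + 2 < W), ∃ i j : ℤ,
      |v m (by omega) - i * hl (line (B (m + 1)))| ≤ R / 4 - 3 / 4 ∧
      |u (m + 1) hmW + j * hl (line (B (m + 2)))| ≤ R / 4 - 3 / 4 ∧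
      |(v m (by omega) - i * hl (line (B (m + 1)))) - (u (m + 1) hmW + j * hl (line (B (m + 2))))|
        ≤ τ (m + 2) - τ (m + 1) := by
    intro m hmW
    have hm1 : m + 1 < W := by omega
    have hd : dist (geod (rev (B (m + 1))) 0) (geod (B (m + 2)) 0) = τ (m + 2) - τ (m + 1) := by
      rw [geod_rev, neg_zero, hB0 _ hm1.le, hB0 _ hmW.le, dist_geod_self, abs_sub_comm, abs_of_pos]
      linarith [hτ _ hm1]
    have h1 := hv m hm1
    rw [show geod (B (m + 1)) (v m hm1) = geod (rev (B (m + 1))) (-v m hm1) by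
      rw [geod_rev, neg_neg]] at h1
    obtain ⟨i, j, e1, e2, e3⟩ := MarkedPants.exists_near_feet (B := rev (B (m + 1)))
      (A := B (m + 2)) (x := 0) (y := 0) hm hF hR hθ hθ1 hb (P (m + 1) hm1)
      (Q (m + 1) hm1) (hPQ _ hm1) (by rw [line_rev]; exact hPc _ hm1) (hQc _ hm1)
      (fun z hz => by
        have := mem_rightSide.1 (hPr _ hm1 hz)
        rw [mem_leftSide, side_rev]; linarith)
      (hQl _ hm1) (by rw [line_rev]; exact hne _ hm1) h1 (hu (m + 1) hmW)
      (by rw [hd]; exact hshort _ hm1)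
    rw [hd, line_rev] at e3
    rw [line_rev] at e1
    refine ⟨i, j, ?_, ?_, ?_⟩
    · convert e1 using 2; ring
    · rw [← abs_neg]; convert e2 using 2; ring
    · convert e3 using 2; ring
  choose i j hi hj hij using hpass
  -- the twist moves the position by exactly `s`, no multiple of the half length intervenes
  have hstep : ∀ m (hmW : m + 3 < W),
      v (m + 1) (by omega) - i (m + 1) hmW * hl (line (B (m + 2))) =
        u (m + 1) (by omega) + j m (by omega) * hl (line (B (m + 2))) + s (line (B (m + 2))) := by
    intro m hmW
    have h1 : |v (m + 1) (by omega) - i (m + 1) hmW * hl (line (B (m + 2)))| ≤ R / 4 - 3 / 4 :=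
      hi (m + 1) hmW
    have h2 := hj m (by omega)
    have h3 : v (m + 1) (by omega) - u (m + 1) (by omega) =
      s (line (B (m + 2))) + k (m + 1) (by omega) * hl (line (B (m + 2))) := huv (m + 1) (by omega)
    have h4 := hb _ (hB (m + 2) (by omega))
    have h5 := hs _ (hB (m + 2) (by omega))
    set h := hl (line (B (m + 2)))
    set σ := s (line (B (m + 2)))
    set K : ℤ := k (m + 1) (by omega) - i (m + 1) hmW - j m (by omega) with hK
    have h6 : v (m + 1) (by omega) - i (m + 1) hmW * h =
        u (m + 1) (by omega) + j m (by omega) * h + σ + K * h := by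
      rw [hK]; push_cast; linarith
    rw [h6, abs_le] at h1
    rw [abs_le] at h2 h4 h5
    have hK0 : K = 0 := by
      rcases lt_trichotomy K 0 with hneg | h0 | hpos
      · exfalso
        have : (K : ℝ) ≤ -1 := by exact_mod_cast Int.le_sub_one_of_lt hneg
        have : (K : ℝ) * h ≤ -1 * h := mul_le_mul_of_nonneg_right this (by linarith)
        linarith
      · exact h0
      · exfalso
        have : (1 : ℝ) ≤ K := by exact_mod_cast hpos
        have : 1 * h ≤ (K : ℝ) * h := mul_le_mul_of_nonneg_right this (by linarith)
        linarith
    rw [h6, hK0]; simp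
  -- every crossing adds at least `1 - θ`, and a passage takes back at most its length
  have hprog : ∀ m (hmW : m + 2 < W), v 0 (by omega) - i 0 (by omega) * hl (line (B 1))
      + m * (1 - θ) - (τ (m + 1) - τ 1) ≤ v m (by omega) - i m hmW * hl (line (B (m + 1))) := by
    intro m
    induction m with
    | zero => intro _; simp
    | succ m ih =>
      intro hmW
      have h1 := ih (by omega)
      have h2 := hstep m hmW
      have h3 := (abs_le.1 (hij m (by omega))).2
      have h4 := (abs_le.1 (hs _ (hB (m + 2) (by omega)))).1
      change _ - (τ (m + 2) - τ 1) ≤ v (m + 1) _ - i (m + 1) _ * hl (line (B (m + 2)))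
      rw [h2]
      push_cast
      linarith
  by_cases hW : W < 3
  · have : (W : ℝ) < 3 := by exact_mod_cast hW
    linarith
  · obtain ⟨m, rfl⟩ : ∃ m, W = m + 3 := ⟨W - 3, by omega⟩
    have h1 := hprog m (by omega)
    have h2 := (abs_le.1 (hi 0 (by omega))).1
    have h3 := (abs_le.1 (hi m (by omega))).2
    have hmono : ∀ n, n ≤ m + 3 → ∀ l ≤ n, τ l ≤ τ n := by
      intro n
      induction n with
      | zero => intro _ l hl; rw [Nat.le_zero.1 hl]
      | succ n ih =>
        intro hn l hl
        rcases Nat.le_succ_iff.1 hl with h | h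
        · exact (ih (by omega) l h).trans (hτ n (by omega)).le
        · rw [h]
    have h4 := hmono (m + 3) le_rfl (m + 1) (by omega)
    have h5 := hmono 1 (by omega) 0 (by omega)
    have h6 : (m : ℝ) * 0.95 ≤ m * (1 - θ) :=
      mul_le_mul_of_nonneg_left (by linarith) (Nat.cast_nonneg m)
    push_cast
    linarith

/-! ### Counting the crossings -/

/-- Only finitely many lifts meet a compact set. -/
theorem finite_setOf_meets (hG : IsClosedSurfaceGroup G) (hm : IsLiftedMulticurve G 𝓛) {K : Set ℍ}
    (hK : IsCompact K) : {L : Set ℍ | L ∈ 𝓛 ∧ (L ∩ K).Nonempty}.Finite := by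
  obtain ⟨F, hF, hFL, hcov⟩ := hm.finite
  -- the translates of a single geodesic
  have h1 : ∀ M ∈ F, {L : Set ℍ | ∃ g ∈ G, L = translate g M ∧ (L ∩ K).Nonempty}.Finite := by
    intro M hM
    obtain ⟨B, c, hc, ℓ, rfl, hT⟩ := hm.closed_geodesic M (hFL hM)
    have hK' : IsCompact (K ∪ geod B '' Set.Icc 0 ℓ) :=
      hK.union (isCompact_Icc.image (continuous_geod B))
    refine ((hG.properly_discontinuous _ hK').image fun g => translate g (line B)).subset ?_
    rintro _ ⟨g, hg, rfl, ⟨_, ⟨_, ⟨t, rfl⟩, rfl⟩, hmem⟩⟩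
    -- move the point of `line B` into the fundamental segment of the translation `c`
    obtain ⟨k, hk, -⟩ := existsUnique_sub_zsmul_mem_Ico hT.1 t 0
    refine ⟨g * c ^ k, ⟨mul_mem hg (zpow_mem hc k), ?_⟩, ?_⟩
    · refine ⟨g • geod B t, ⟨geod B (t - k • ℓ), Or.inr ⟨_, ?_, rfl⟩, ?_⟩, Or.inl hmem⟩
      · rw [zero_add] at hk
        exact ⟨hk.1, hk.2.le⟩
      · change (g * c ^ k) • geod B (t - k • ℓ) = g • geod B t
        rw [mul_smul, hT.zpow, zsmul_eq_mul]; simp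
    · simp only [translate_mul]
      rw [translate_stab_zpow hT.line_eq]
  refine (hF.biUnion h1).subset ?_
  rintro L ⟨hL, hLK⟩
  obtain ⟨g, hg, M, hM, rfl⟩ := hcov L hL
  exact Set.mem_biUnion hM ⟨g, hg, rfl, hLK⟩

/-- A geodesic that is not contained in `L` crosses `L` once, from left to right for one of the
orientations of `L`. -/
theorem exists_crossing_orientation {A B : SL(2, ℝ)} {u v : ℝ} (hu : geod A u ∈ line B)
    (hv : geod A v ∉ line B) : ∃ D, line D = line B ∧ geod D 0 = geod A u ∧
      (∀ t, t < u → side D (geod A t) < 0) ∧ ∀ t, u < t → 0 < side D (geod A t) := by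
  rw [mem_line] at hv
  have hu0 := mem_line.1 hu
  have hne : v - u ≠ 0 := by
    intro h
    rw [sub_eq_zero.1 h] at hv
    exact hv hu0
  have hsinh : Real.sinh (v - u) ≠ 0 := Real.sinh_ne_zero.2 hne
  obtain ⟨c, hc0, hc⟩ : ∃ c, c ≠ 0 ∧ ∀ t, side B (geod A t) = c * Real.sinh (t - u) := by
    refine ⟨side B (geod A v) / Real.sinh (v - u), div_ne_zero hv hsinh, fun t => ?_⟩
    have := side_interp B A u t v
    rw [hu0, mul_zero, zero_add] at this
    field_simp
    linarith
  have main : ∀ B', line B' = line B → ∀ c', 0 < c' →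
      (∀ t, side B' (geod A t) = c' * Real.sinh (t - u)) → ∃ D, line D = line B ∧
      geod D 0 = geod A u ∧ (∀ t, t < u → side D (geod A t) < 0) ∧
      ∀ t, u < t → 0 < side D (geod A t) := by
    intro B' hB' c' hc' h
    obtain ⟨t₀, ht₀⟩ : geod A u ∈ line B' := hB' ▸ hu
    refine ⟨shift B' t₀, by rw [line_shift, hB'], by rw [geod_shift, zero_add, ht₀], ?_, ?_⟩
    · intro t ht
      rw [side_shift, h]
      exact mul_neg_of_pos_of_neg hc' (Real.sinh_neg_iff.2 (by linarith))
    · intro t ht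
      rw [side_shift, h]
      exact mul_pos hc' (Real.sinh_pos_iff.2 (by linarith))
  rcases lt_or_gt_of_ne hc0 with h | h
  · exact main (rev B) (line_rev B) (-c) (by linarith) fun t => by rw [side_rev, hc]; ring
  · exact main B rfl c h hc

/-- If a geodesic segment of length one meets at least `n ≥ 2` lifts, it meets `n` lifts one after
the other. -/
theorem exists_crossing_sequence (hm : IsLiftedMulticurve G 𝓛) (A : SL(2, ℝ))
    (hfin : {L : Set ℍ | L ∈ 𝓛 ∧ (L ∩ geod A '' Set.Icc 0 1).Nonempty}.Finite)
    (hn : 2 ≤ {L : Set ℍ | L ∈ 𝓛 ∧ (L ∩ geod A '' Set.Icc 0 1).Nonempty}.ncard) :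
    ∃ (τ : ℕ → ℝ) (B : ℕ → SL(2, ℝ)), (∀ n, τ n ∈ Set.Icc 0 1) ∧
      (∀ n, line (B n) ∈ 𝓛) ∧ (∀ n, geod (B n) 0 = geod A (τ n)) ∧
      (∀ n t, t < τ n → side (B n) (geod A t) < 0) ∧
      (∀ n t, τ n < t → 0 < side (B n) (geod A t)) ∧
      ∀ n, n + 1 < {L : Set ℍ | L ∈ 𝓛 ∧ (L ∩ geod A '' Set.Icc 0 1).Nonempty}.ncard →
        τ n < τ (n + 1) ∧ ∀ t ∈ Set.Ioo (τ n) (τ (n + 1)), geod A t ∈ (⋃₀ 𝓛)ᶜ := by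
  set H := {L : Set ℍ | L ∈ 𝓛 ∧ (L ∩ geod A '' Set.Icc 0 1).Nonempty} with hH
  have hex : ∀ L ∈ H, ∃ t ∈ Set.Icc (0 : ℝ) 1, geod A t ∈ L := by
    rintro L ⟨-, _, hL, t, ht, rfl⟩
    exact ⟨t, ht, hL⟩
  choose! T hT hTL using hex
  have hdisj : ∀ L ∈ H, ∀ M ∈ H, L ≠ M → ∀ t, geod A t ∈ L → geod A t ∉ M :=
    fun L hL M hM hne t h1 h2 =>
      Set.disjoint_left.1 (hm.pairwise_disjoint _ hL.1 _ hM.1 hne) h1 h2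
  have hinj : Set.InjOn T H := by
    intro L hL M hM h
    by_contra hne
    exact hdisj L hL M hM hne _ (hTL L hL) (h ▸ hTL M hM)
  have horient : ∀ L ∈ H, ∃ B, line B = L ∧ geod B 0 = geod A (T L) ∧
      (∀ t, t < T L → side B (geod A t) < 0) ∧ ∀ t, T L < t → 0 < side B (geod A t) := by
    intro L hL
    obtain ⟨M, hM, hne⟩ := Set.exists_ne_of_one_lt_ncard (s := H) (by omega) L
    obtain ⟨B, rfl⟩ := hm.exists_line hL.1
    exact exists_crossing_orientation (hTL _ hL) (hdisj M hM _ hL hne _ (hTL M hM))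
  choose! D hD hD0 hDl hDr using horient
  have hSfin : (T '' H).Finite := hfin.image T
  have hcard : hSfin.toFinset.card = H.ncard := by
    rw [← Set.ncard_eq_toFinset_card _ hSfin, hinj.ncard_image]
  set e := hSfin.toFinset.orderEmbOfFin hcard with he
  set i : ℕ → Fin H.ncard := fun n => ⟨min n (H.ncard - 1), by omega⟩ with hi
  have hmem : ∀ n, ∃ L ∈ H, T L = e (i n) := fun n => by
    exact hSfin.mem_toFinset.1 (hSfin.toFinset.orderEmbOfFin_mem hcard (i n))
  choose L hLH hLT using hmem
  refine ⟨fun n => e (i n), fun n => D (L n), fun n => ?_, fun n => ?_, fun n => ?_, fun n => ?_,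
    fun n => ?_, fun n hnlt => ⟨?_, ?_⟩⟩
  · simp only [← hLT]; exact hT _ (hLH n)
  · simp only [hD _ (hLH n)]; exact (hLH n).1
  · simp only [← hLT]; exact hD0 _ (hLH n)
  · simp only [← hLT]; exact hDl _ (hLH n)
  · simp only [← hLT]; exact hDr _ (hLH n)
  · apply e.strictMono
    simp only [hi, Fin.mk_lt_mk]
    omega
  · rintro t ht ⟨M, hM, htM⟩
    have h01 : t ∈ Set.Icc (0 : ℝ) 1 := by
      have h1 := hT _ (hLH n)
      have h2 := hT _ (hLH (n + 1))
      rw [hLT] at h1 h2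
      exact ⟨h1.1.trans ht.1.le, ht.2.le.trans h2.2⟩
    have hMH : M ∈ H := ⟨hM, _, htM, t, h01, rfl⟩
    have htT : t = T M := by
      rw [← hD M hMH, mem_line] at htM
      rcases lt_trichotomy t (T M) with h | h | h
      · exact absurd htM (hDl M hMH t h).ne
      · exact h
      · exact absurd htM (hDr M hMH t h).ne'
    have : t ∈ Set.range e := by
      rw [he, Finset.range_orderEmbOfFin, htT]
      simpa using ⟨M, hMH, rfl⟩
    obtain ⟨j, rfl⟩ := this
    have h1 := e.lt_iff_lt.1 ht.1
    have h2 := e.lt_iff_lt.1 ht.2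
    simp only [hi, Fin.lt_def] at h1 h2
    omega

end HypPants

open HypPants in
theorem lemma3p2 (ε : ℝ) (hε : 0 < ε) :
    ∃ R₀ : ℝ, ∀ R : ℝ, R₀ ≤ R →
      ∀ (G : Subgroup SL(2, ℝ)) (𝓛 : Set (Set ℍ)) (hl s : Set ℍ → ℝ),
        IsClosedSurfaceGroup G →
        IsLiftedPantsDecomposition G 𝓛 →
        IsFenchelNielsen G 𝓛 hl s →
        (∀ L ∈ 𝓛, |hl L - R / 2| < ε / R) →
        (∀ L ∈ 𝓛, |s L - 1| < ε / R) →
        ∀ a : Set ℍ, IsUnitGeodesicArc a →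
          {L : Set ℍ | L ∈ 𝓛 ∧ (L ∩ a).Nonempty}.Finite ∧
          (({L : Set ℍ | L ∈ 𝓛 ∧ (L ∩ a).Nonempty}.ncard : ℕ) : ℝ) ≤ 2 * R + 2 := by
  refine ⟨max 100 (20 * ε), fun R hR G 𝓛 hl s hG hp hF hb hs a ha => ?_⟩
  have hR1 : 100 ≤ R := (le_max_left _ _).trans hR
  have hR2 : 20 * ε ≤ R := (le_max_right _ _).trans hR
  have hθ : 0 ≤ ε / R := by positivity
  have hθ1 : ε / R ≤ 1 / 20 := by rw [div_le_iff₀ (by linarith)]; linarith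
  obtain ⟨A, rfl⟩ := ha.exists_geod
  have hfin := finite_setOf_meets hG hp.multicurve
    ((isCompact_Icc (a := (0 : ℝ)) (b := 1)).image (continuous_geod A))
  refine ⟨hfin, ?_⟩
  by_contra! hcon
  have hn : 2 ≤ {L : Set ℍ | L ∈ 𝓛 ∧ (L ∩ geod A '' Set.Icc 0 1).Nonempty}.ncard := by
    have : (2 : ℝ) < ({L : Set ℍ | L ∈ 𝓛 ∧ (L ∩ geod A '' Set.Icc 0 1).Nonempty}.ncard : ℝ) := by
      linarith
    exact_mod_cast this.le
  obtain ⟨τ, B, hτ, hB, hB0, hBl, hBr, hgap⟩ :=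
    exists_crossing_sequence hp.multicurve A hfin hn
  set N := {L : Set ℍ | L ∈ 𝓛 ∧ (L ∩ geod A '' Set.Icc 0 1).Nonempty}.ncard
  -- each of three disjoint windows of `W` consecutive passages contains a long one
  set W := ⌊0.6 * R⌋₊ + 4 with hW
  have hW1 : 0.6 * R + 3 < W := by
    rw [hW]; push_cast; linarith [Nat.lt_floor_add_one (0.6 * R)]
  have hW2 : (W : ℝ) ≤ 0.6 * R + 4 := by
    rw [hW]; push_cast; linarith [Nat.floor_le (show 0 ≤ 0.6 * R by linarith)]
  have hWN : 3 * W < N := by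
    have : ((3 * W : ℕ) : ℝ) < N := by push_cast; linarith
    exact_mod_cast this
  have hmono : ∀ n m, n + m < N → τ n ≤ τ (n + m) := by
    intro n m
    induction m with
    | zero => intro _; simp
    | succ m ih => intro h; exact (ih (by omega)).trans (hgap (n + m) (by omega)).1.le
  have hlong : ∀ j < 3, τ (j * W) + 3 / 8 ≤ τ ((j + 1) * W) := by
    intro j hj
    have hjW : (j + 1) * W < N := lt_of_le_of_lt (Nat.mul_le_mul_right W hj) hWN
    rw [add_mul, one_mul] at hjW ⊢
    by_contra! hlt
    have hshort : ∀ n < W, τ (j * W + (n + 1)) - τ (j * W + n) < 3 / 8 := by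
      intro n hnW
      have h1 := hmono (j * W) n (by omega)
      have h2 := hmono (j * W + (n + 1)) (W - (n + 1)) (by omega)
      rw [show j * W + (n + 1) + (W - (n + 1)) = j * W + W by omega] at h2
      linarith
    have := short_passages_le hp hF hR1 hθ hθ1 (fun L hL => (hb L hL).le)
      (fun L hL => (hs L hL).le) A W (fun n => τ (j * W + n)) (fun n => B (j * W + n))
      (fun n hnW => (hgap (j * W + n) (by omega)).1)
      (by linarith [(hτ (j * W + W)).2, (hτ (j * W + 0)).1])
      (fun n _ => hB _) (fun n _ => hB0 _) (fun n _ => hBl _) (fun n _ => hBr _)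
      (fun n hnW => (hgap (j * W + n) (by omega)).2) hshort
    linarith
  have h0 := hlong 0 (by norm_num)
  have h1 := hlong 1 (by norm_num)
  have h2 := hlong 2 (by norm_num)
  norm_num at h0 h1 h2
  linarith [(hτ 0).1, (hτ (3 * W)).2]
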